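/- \textbf{Setting.} Let $\mathcal X,\mathcal Y,\mathcal Z$ be measurable spaces, let $\delta$ be a distance on $\mathcal Z$ (a pseudometric is enough), and let $\{B_1,\dots,B_M\}$ be a partition of $\mathcal Z$ into measurable bins, with maximum diameter $h=\max_{m}\sup_{z,z'\in B_m}\delta(z,z')\in[0,\infty]$ (which is finite when, for example, $\mathcal Z$ is compact for $\delta$). \textbf{Rényi divergence.} For $\gamma\in(0,\infty)$ and probability measures $P,Q$ with densities $p,q$ with respect to a common dominating measure $\mu$, let $$\mathcal D_{\gamma,\mathrm R}(P\|Q)=\frac1{\gamma-1}\log\int p^{\gamma}q^{1-\gamma}\,d\mu\quad(\gamma\ne1),\qquad \mathcal D_{1,\mathrm R}(P\|Q)=\int p\log\frac pq\,d\mu,$$ with values in $[0,\infty]$ and the usual conventions (the divergence is $\infty$ if $\gamma\ge1$ and $P\not\ll Q$, or if $\gamma<1$ and $P\perp Q$). \textbf{Null class.} For $L\ge0$, let $\mathcal P_{0,\mathrm R,\gamma,\delta}(L)$ be the set of laws $P_{X,Y,Z}$ on $\mathcal X\times\mathcal Y\times\mathcal Z$ such that $X$ and $Y$ are conditionally independent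 given $Z$ and there are (versions of the) conditional distributions $P_{X|Z=z}$, $P_{Y|Z=z}$ with $P_{X,Y|Z=z}=P_{X|Z=z}\otimes P_{Y|Z=z}$ for $P_Z$-almost every $z$ and, for all $z,z'\in\mathcal Z$, $$\mathcal D_{\gamma,\mathrm R}^{1/2}(P_{X|Z=z}\|P_{X|Z=z'})\le L\,\delta(z,z')\quad\text{and}\quad \mathcal D_{\gamma,\mathrm R}^{1/2}(P_{Y|Z=z}\|P_{Y|Z=z'})\le L\,\delta(z,z').$$ \textbf{Local permutation test.} Given $n$ observations $(X_i,Y_i,Z_i)$, let $W_m$ be the list of the pairs $(X_i,Y_i)$ with $Z_i\in B_m$, in increasing order of $i$, and let $\sigma_m$ be its length. For a permutation $\pi_m$ of $\{1,\dots,\sigma_m\}$, let $W_m^{\pi_m}$ be the list obtained from $W_m$ by replacing its $j$th pair $(X_{j,m},Y_{j,m})$ with $(X_{j,m},Y_{\pi_m(j),m})$. Let $f$ be any measurable real-valued function of $(W_1,\dots,W_M)$, put $T=f(W_1,\dots,W_M)$ and $T^{\pi}=f(W_1^{\pi_1},\dots,W_M^{\pi_M})$ for each of the $K=\prod_m\sigma_m!$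 local permutations $\pi=(\pi_1,\dots,\pi_M)$, and let $$p_{\mathrm{perm}}=\frac1K\sum_{\pi}\mathbf 1\{T^{\pi}\ge T\},\qquad \phi_{\mathrm{perm},n}=\mathbf 1\{p_{\mathrm{perm}}\le\alpha\}.$$ \textbf{Theorem.} For every $\gamma>0$ there is a finite constant $C_\gamma\ge0$, depending only on $\gamma$, such that for all spaces, partitions and statistics $f$ as above, all $n$, all $L\ge0$ and all $\alpha\in(0,1)$, $$\sup_{P_{X,Y,Z}\in\mathcal P_{0,\mathrm R,\gamma,\delta}(L)}\mathbb E_{P^n_{X,Y,Z}}[\phi_{\mathrm{perm},n}]\;\le\;\alpha+C_\gamma\,n^{1/2}L^2h^2,$$ with the convention $0\cdot\infty=0$ on the right-hand side. -/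

import Mathlib

open MeasureTheory ProbabilityTheory
open scoped ENNReal NNReal Nat

namespace LocalPerm

/-! ### Rényi divergence and Rényi-Lipschitz null distributions -/

section Renyi

variable {Ω : Type*} [MeasurableSpace Ω]

/-- `∫ p ^ γ * q ^ (1 - γ) dμ`, where `p`, `q` are the densities of `P`, `Q` with respect to the
dominating measure `μ = P + Q` (the value does not depend on the choice of `μ`). The operations of
`ℝ≥0∞` give the usual conventions: where `q = 0 < p`, the integrand is `0` if `γ < 1` and `∞` if
`γ > 1`; where `p = 0` it is `0`. -/
noncomputable def renyiIntegral (γ : ℝ) (P Q : Measure Ω) : ℝ≥0∞ :=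
  ∫⁻ x, (P.rnDeriv (P + Q) x) ^ γ * (Q.rnDeriv (P + Q) x) ^ (1 - γ) ∂(P + Q)

/-- The Rényi divergence of order `γ` of the probability measure `P` from the probability
measure `Q`; it is the Kullback-Leibler divergence for `γ = 1`. Since the divergence of two
probability measures is nonnegative, it is given as an element of `ℝ≥0∞`. -/
noncomputable def renyiDiv (γ : ℝ) (P Q : Measure Ω) : ℝ≥0∞ :=
  if γ = 1 then InformationTheory.klDiv P Q
  else ((((γ - 1)⁻¹ : ℝ) : EReal) * ENNReal.log (renyiIntegral γ P Q)).toENNReal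

end Renyi

section Null

variable {𝓧 𝓨 𝓩 : Type*} [MeasurableSpace 𝓧] [MeasurableSpace 𝓨] [MeasurableSpace 𝓩]

/-- The family of distributions `κ z` is Lipschitz with constant `L` in the square root of the
Rényi divergence of order `γ`. -/
def RenyiLipschitz [PseudoMetricSpace 𝓩] (γ : ℝ) (L : ℝ≥0) (κ : Kernel 𝓩 𝓧) : Prop :=
  ∀ z z' : 𝓩, (renyiDiv γ (κ z) (κ z')) ^ (1 / 2 : ℝ) ≤ L * edist z z'

/-- Under the law `P` of `(X, Y, Z)`, the kernels `κX` and `κY` are (versions of) the conditional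
distributions of `X` given `Z` and of `Y` given `Z`, and `X` and `Y` are conditionally independent
given `Z`: the conditional distribution of `(X, Y)` given `Z = z` is the product of `κX z` and
`κY z`. -/
structure IsCondIndepWith (P : Measure (𝓧 × 𝓨 × 𝓩)) (κX : Kernel 𝓩 𝓧) (κY : Kernel 𝓩 𝓨) :
    Prop where
  condDistrib_left : HasCondDistrib (fun w => w.1) (fun w => w.2.2) κX P
  condDistrib_right : HasCondDistrib (fun w => w.2.1) (fun w => w.2.2) κY P
  condIndep : HasCondDistrib (fun w => (w.1, w.2.1)) (fun w => w.2.2) (κX ×ₖ κY) P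

/-- The class of laws `P` of `(X, Y, Z)` with `X` and `Y` conditionally independent given `Z`, and
with conditional distributions of `X` given `Z = z` and of `Y` given `Z = z` that are Lipschitz in
`z` with constant `L`, in the square root of the Rényi divergence of order `γ`. -/
def renyiNull (𝓧 𝓨 𝓩 : Type*) [MeasurableSpace 𝓧] [MeasurableSpace 𝓨] [MeasurableSpace 𝓩]
    [PseudoMetricSpace 𝓩] (γ : ℝ) (L : ℝ≥0) : Set (Measure (𝓧 × 𝓨 × 𝓩)) :=
  {P | IsProbabilityMeasure P ∧
    ∃ (κX : Kernel 𝓩 𝓧) (κY : Kernel 𝓩 𝓨), IsMarkovKernel κX ∧ IsMarkovKernel κY ∧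
      IsCondIndepWith P κX κY ∧ RenyiLipschitz γ L κX ∧ RenyiLipschitz γ L κY}

end Null

/-! ### The local permutation test -/

section Test

variable {𝓧 𝓨 𝓩 : Type*}

/-- The content of one bin: its sample size `k` and its `k` pairs, listed in order. -/
abbrev BinSample (𝓧 𝓨 : Type*) : Type _ := Σ k : ℕ, Fin k → 𝓧 × 𝓨

/-- Permute the second coordinates: `(X_i, Y_i)` is replaced by `(X_i, Y_{π(i)})`. -/
def BinSample.permute (W : BinSample 𝓧 𝓨) (π : Equiv.Perm (Fin W.1)) : BinSample 𝓧 𝓨 :=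
  ⟨W.1, fun i => ((W.2 i).1, (W.2 (π i)).2)⟩

/-- The local permutations of binned data: one permutation for each bin. -/
abbrev LocalPermutation {M : ℕ} (W : Fin M → BinSample 𝓧 𝓨) : Type :=
  (m : Fin M) → Equiv.Perm (Fin (W m).1)

open Classical in
/-- The indices of the observations whose `Z`-value lies in the set `B`. -/
noncomputable def binIndices {n : ℕ} (B : Set 𝓩) (w : Fin n → 𝓧 × 𝓨 × 𝓩) : Finset (Fin n) :=
  Finset.univ.filter (fun i => (w i).2.2 ∈ B)

/-- The pairs `(X_i, Y_i)` for which `Z_i ∈ B`, listed in increasing order of `i`. -/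
noncomputable def binSample {n : ℕ} (B : Set 𝓩) (w : Fin n → 𝓧 × 𝓨 × 𝓩) : BinSample 𝓧 𝓨 :=
  ⟨(binIndices B w).card, fun j =>
    let i := (binIndices B w).orderEmbOfFin rfl j
    ((w i).1, (w i).2.1)⟩

/-- The binned data `W_1, …, W_M`. -/
noncomputable def binnedData {n M : ℕ} (B : Fin M → Set 𝓩) (w : Fin n → 𝓧 × 𝓨 × 𝓩) :
    Fin M → BinSample 𝓧 𝓨 :=
  fun m => binSample (B m) w

open Classical in
/-- The permutation p-value: the proportion of the `K = ∏ m, σ_m !` local permutations for which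
the permuted statistic is at least the observed one. -/
noncomputable def permPValue {M : ℕ} (f : (Fin M → BinSample 𝓧 𝓨) → ℝ)
    (W : Fin M → BinSample 𝓧 𝓨) : ℝ :=
  (1 / (∏ m, (((W m).1)! : ℝ))) *
    ∑ π : LocalPermutation W, if f W ≤ f (fun m => (W m).permute (π m)) then 1 else 0

open Classical in
/-- The local permutation test with statistic `f`, bins `B` and nominal level `α`: its value is `1`
(reject) if the permutation p-value is at most `α`, and `0` otherwise. -/
noncomputable def permTest {n M : ℕ} (B : Fin M → Set 𝓩) (f : (Fin M → BinSample 𝓧 𝓨) → ℝ)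
    (α : ℝ) (w : Fin n → 𝓧 × 𝓨 × 𝓩) : ℝ≥0∞ :=
  if permPValue f (binnedData B w) ≤ α then 1 else 0

/-- A partition of `𝓩` into finitely many measurable bins. -/
structure IsBinning [MeasurableSpace 𝓩] {M : ℕ} (B : Fin M → Set 𝓩) : Prop where
  measurableSet : ∀ m, MeasurableSet (B m)
  disjoint : Pairwise (fun m m' => Disjoint (B m) (B m'))
  iUnion_eq : ⋃ m, B m = Set.univ

/-- The maximum diameter `h` of the bins. -/
noncomputable def maxDiam [PseudoMetricSpace 𝓩] {M : ℕ} (B : Fin M → Set 𝓩) : ℝ≥0∞ :=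
  ⨆ m, ⨆ z ∈ B m, ⨆ z' ∈ B m, edist z z'

end Test

end LocalPerm

/-!
The rate `√n L² h²`, instead of the rate `√n L h` that comes from moving all observations of a bin
to one value of `Z`, has two sources: the test sees `Z` only through its bin, and both conditional
distributions vary slowly inside a bin.

Let `R` be the law of `(X, Y, m)`, where `m` is the label of the bin of `Z` (`binnedLaw`), and let
`S` be the law with the same `(X, m)` and `(Y, m)` marginals under which `X` and `Y` are independent
given `m` (`decoupledLaw`). Under `S` the second coordinates inside a bin are exchangeable given
everything else, so the permutation test has level `α` without any error term
(`lintegral_permTest_labelBins_le`). It remains to compare the `n`-fold products of `R` and `S` in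
total variation, which is at most of the order of `√n H(R, S)` with `H` the Hellinger distance
(`lintegral_pi_le_add_hellSq`).

With `z`, `z'` independent draws of `Z` from the same bin, `R - S` is half the average of
`(P_z - P_z') ⊗ (Q_z - Q_z')`, where `P_z` and `Q_z` are the conditional distributions of `X` and
`Y`. Writing `p - p' = (√p - √p') (√p + √p')`, and likewise for `q`, the Cauchy-Schwarz inequality
bounds the integral of a function `g` against this signed measure in terms of the *product* of the
squared Hellinger distances and of the integral of `g ^ 2` (`lintegral_prod_add_le`); hence
`H(R, S) ^ 2` is of the order of `(L h) ^ 4` (`hellSq_binnedLaw_decoupledLaw_le`). The bound is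
carried out for integrals of test functions (`hellSq_le_of_forall_lintegral_le`), because
conditional densities that are jointly measurable in `(x, z)` need not exist on general measurable
spaces.

Finally, the squared Hellinger distance is at most a constant times the Rényi divergence of any
order `γ > 0` (`hellSq_le_renyiDiv`), by refined forms of Young's inequality.
-/

namespace LocalPerm

/-! ### The squared Hellinger distance -/

section Hellinger

variable {Ω : Type*} [MeasurableSpace Ω]

/-- The density of `P` with respect to `μ`, as a real-valued function. -/
noncomputable def dens (P μ : Measure Ω) (x : Ω) : ℝ := (P.rnDeriv μ x).toReal

lemma dens_nonneg (P μ : Measure Ω) (x : Ω) : 0 ≤ dens P μ x := ENNReal.toReal_nonneg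

@[fun_prop]
lemma measurable_dens (P μ : Measure Ω) : Measurable (dens P μ) :=
  (Measure.measurable_rnDeriv P μ).ennreal_toReal

lemma withDensity_dens {P μ : Measure Ω} [IsFiniteMeasure P] [IsFiniteMeasure μ] (h : P ≪ μ) :
    μ.withDensity (fun x => ENNReal.ofReal (dens P μ x)) = P := by
  conv_rhs => rw [← Measure.withDensity_rnDeriv_eq P μ h]
  refine withDensity_congr_ae ?_
  filter_upwards [Measure.rnDeriv_ne_top P μ] with x hx
  exact ENNReal.ofReal_toReal hx

lemma lintegral_dens_mul {P μ : Measure Ω} [IsFiniteMeasure P] [IsFiniteMeasure μ] (h : P ≪ μ)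
    {f : Ω → ℝ≥0∞} (hf : Measurable f) :
    ∫⁻ x, ENNReal.ofReal (dens P μ x) * f x ∂μ = ∫⁻ x, f x ∂P := by
  conv_rhs => rw [← withDensity_dens h]
  rw [lintegral_withDensity_eq_lintegral_mul _ (by fun_prop) hf]
  rfl

lemma lintegral_dens {P μ : Measure Ω} [IsProbabilityMeasure P] [IsFiniteMeasure μ] (h : P ≪ μ) :
    ∫⁻ x, ENNReal.ofReal (dens P μ x) ∂μ = 1 := by
  simpa using lintegral_dens_mul h (f := fun _ => 1) measurable_const

lemma absolutelyContinuous_add_left (P Q : Measure Ω) : P ≪ P + Q :=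
  Measure.AbsolutelyContinuous.rfl.add_right _

lemma absolutelyContinuous_add_right (P Q : Measure Ω) : Q ≪ P + Q :=
  Measure.AbsolutelyContinuous.rfl.add_right' _

/-- The squared Hellinger distance `∫ (√p - √q) ^ 2`, where `p` and `q` are the densities of `P`
and `Q` with respect to `P + Q`. -/
noncomputable def hellSq (P Q : Measure Ω) : ℝ≥0∞ :=
  ∫⁻ x, ENNReal.ofReal ((√(dens P (P + Q) x) - √(dens Q (P + Q) x)) ^ 2) ∂(P + Q)

lemma hellSq_le_two (P Q : Measure Ω) [IsProbabilityMeasure P] [IsProbabilityMeasure Q] :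
    hellSq P Q ≤ 2 := by
  calc hellSq P Q
      ≤ ∫⁻ x, (ENNReal.ofReal (dens P (P + Q) x) + ENNReal.ofReal (dens Q (P + Q) x)) ∂(P + Q) := by
        refine lintegral_mono fun x => ?_
        rw [← ENNReal.ofReal_add (dens_nonneg _ _ _) (dens_nonneg _ _ _)]
        refine ENNReal.ofReal_le_ofReal ?_
        nlinarith [Real.sq_sqrt (dens_nonneg P (P + Q) x), Real.sq_sqrt (dens_nonneg Q (P + Q) x),
          mul_nonneg (Real.sqrt_nonneg (dens P (P + Q) x)) (Real.sqrt_nonneg (dens Q (P + Q) x))]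
    _ = 2 := by
        rw [lintegral_add_left (by fun_prop), lintegral_dens (absolutelyContinuous_add_left P Q),
          lintegral_dens (absolutelyContinuous_add_right P Q), one_add_one_eq_two]

/-! ### The Hellinger distance is dominated by the Rényi divergences -/

/-- A refinement of Young's inequality: the gap dominates the squared difference of the roots. -/
lemma rpow_mul_rpow_add_le {γ : ℝ} (h0 : 0 < γ) (h1 : γ < 1) {p q : ℝ} (hp : 0 ≤ p)
    (hq : 0 ≤ q) :
    p ^ γ * q ^ (1 - γ) + min γ (1 - γ) * (√p - √q) ^ 2 ≤ γ * p + (1 - γ) * q := by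
  have key : ∀ {a : ℝ}, 0 < a → a ≤ 1 / 2 → ∀ {x y : ℝ}, 0 ≤ x → 0 ≤ y →
      x ^ a * y ^ (1 - a) + a * (√x - √y) ^ 2 ≤ a * x + (1 - a) * y := by
    intro a ha ha2 x y hx hy
    have h := Real.geom_mean_le_arith_mean2_weighted (w₁ := 2 * a) (w₂ := 1 - 2 * a)
      (by linarith) (by linarith) (mul_nonneg (Real.sqrt_nonneg x) (Real.sqrt_nonneg y)) hy
      (by ring)
    have hpow : (√x * √y) ^ (2 * a) * y ^ (1 - 2 * a) = x ^ a * y ^ (1 - a) := by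
      rw [Real.mul_rpow (Real.sqrt_nonneg _) (Real.sqrt_nonneg _), Real.sqrt_eq_rpow,
        Real.sqrt_eq_rpow, ← Real.rpow_mul hx, ← Real.rpow_mul hy, mul_assoc,
        ← Real.rpow_add_of_nonneg hy (by linarith) (by linarith)]
      congr 2 <;> ring
    rw [hpow] at h
    nlinarith [Real.sq_sqrt hx, Real.sq_sqrt hy]
  rcases le_total γ (1 / 2) with h | h
  · rw [min_eq_left (by linarith)]
    exact key h0 h hp hq
  · rw [min_eq_right (by linarith)]
    have := key (a := 1 - γ) (by linarith) (by linarith) hq hp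
    rw [sub_sub_cancel] at this
    nlinarith

/-- A reverse form of Young's inequality for exponents larger than one. -/
lemma mul_add_le_rpow_mul_rpow_add {γ : ℝ} (h1 : 1 < γ) {p q : ℝ} (hp : 0 ≤ p) (hq : 0 < q) :
    γ * p + (γ - 1) * (√p - √q) ^ 2 ≤ p ^ γ * q ^ (1 - γ) + (γ - 1) * q := by
  have hc : 0 < 2 * γ - 1 := by linarith
  -- AM-GM for `p ^ γ * q ^ (1 - γ)` and `√p * √q`, with weights `1 : 2 (γ - 1)`
  have h := Real.geom_mean_le_arith_mean2_weighted (w₁ := 1 / (2 * γ - 1))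
    (w₂ := 2 * (γ - 1) / (2 * γ - 1)) (by positivity)
    (div_nonneg (by linarith) hc.le)
    (mul_nonneg (Real.rpow_nonneg hp γ) (Real.rpow_nonneg hq.le (1 - γ)))
    (mul_nonneg (Real.sqrt_nonneg p) (Real.sqrt_nonneg q))
    (by rw [← add_div, div_eq_one_iff_eq hc.ne']; ring)
  have hpow : (p ^ γ * q ^ (1 - γ)) ^ (1 / (2 * γ - 1)) *
      (√p * √q) ^ (2 * (γ - 1) / (2 * γ - 1)) = p := by
    rw [Real.mul_rpow (Real.rpow_nonneg hp γ) (Real.rpow_nonneg hq.le _),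
      Real.mul_rpow (Real.sqrt_nonneg _) (Real.sqrt_nonneg _), Real.sqrt_eq_rpow,
      Real.sqrt_eq_rpow, ← Real.rpow_mul hp, ← Real.rpow_mul hp, ← Real.rpow_mul hq.le,
      ← Real.rpow_mul hq.le, mul_mul_mul_comm, ← Real.rpow_add hq,
      ← Real.rpow_add_of_nonneg hp (by positivity)
        (mul_nonneg (by norm_num) (div_nonneg (by linarith) hc.le))]
    have e1 : γ * (1 / (2 * γ - 1)) + 1 / 2 * (2 * (γ - 1) / (2 * γ - 1)) = 1 := by
      linear_combination mul_inv_cancel₀ hc.ne'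
    have e2 : (1 - γ) * (1 / (2 * γ - 1)) + 1 / 2 * (2 * (γ - 1) / (2 * γ - 1)) = 0 := by
      field_simp; ring
    rw [e1, e2]; simp
  rw [hpow, div_mul_eq_mul_div, div_mul_eq_mul_div, ← add_div, le_div_iff₀ hc] at h
  nlinarith [Real.sq_sqrt hp, Real.sq_sqrt hq.le]

variable (P Q : Measure Ω) [IsProbabilityMeasure P] [IsProbabilityMeasure Q]

lemma renyiIntegral_add_hellSq_le {γ : ℝ} (h0 : 0 < γ) (h1 : γ < 1) :
    renyiIntegral γ P Q + ENNReal.ofReal (min γ (1 - γ)) * hellSq P Q ≤ 1 := by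
  have hm : 0 ≤ min γ (1 - γ) := le_min h0.le (by linarith)
  unfold renyiIntegral hellSq
  rw [← lintegral_const_mul _ (by fun_prop), ← lintegral_add_right _ (by fun_prop)]
  calc _ ≤ ∫⁻ x, (ENNReal.ofReal γ * ENNReal.ofReal (dens P (P + Q) x)
        + ENNReal.ofReal (1 - γ) * ENNReal.ofReal (dens Q (P + Q) x)) ∂(P + Q) := by
        refine lintegral_mono_ae ?_
        filter_upwards [Measure.rnDeriv_ne_top P (P + Q), Measure.rnDeriv_ne_top Q (P + Q)]
          with x hx hy
        have hp := dens_nonneg P (P + Q) x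
        have hq := dens_nonneg Q (P + Q) x
        rw [← ENNReal.ofReal_toReal hx, ← ENNReal.ofReal_toReal hy]
        change ENNReal.ofReal (dens P (P + Q) x) ^ γ * ENNReal.ofReal (dens Q (P + Q) x) ^ (1 - γ)
          + _ ≤ _
        rw [ENNReal.ofReal_rpow_of_nonneg hp h0.le, ENNReal.ofReal_rpow_of_nonneg hq (by linarith),
          ← ENNReal.ofReal_mul (Real.rpow_nonneg hp _), ← ENNReal.ofReal_mul hm,
          ← ENNReal.ofReal_mul h0.le, ← ENNReal.ofReal_mul (by linarith),
          ← ENNReal.ofReal_add (mul_nonneg (Real.rpow_nonneg hp _) (Real.rpow_nonneg hq _))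
            (mul_nonneg hm (sq_nonneg _)),
          ← ENNReal.ofReal_add (mul_nonneg h0.le hp) (mul_nonneg (by linarith) hq)]
        exact ENNReal.ofReal_le_ofReal (rpow_mul_rpow_add_le h0 h1 hp hq)
    _ = 1 := by
        rw [lintegral_add_left (by fun_prop), lintegral_const_mul _ (by fun_prop),
          lintegral_const_mul _ (by fun_prop), lintegral_dens (absolutelyContinuous_add_left P Q),
          lintegral_dens (absolutelyContinuous_add_right P Q), mul_one, mul_one,
          ← ENNReal.ofReal_add h0.le (by linarith)]
        simp

lemma one_add_hellSq_le_renyiIntegral {γ : ℝ} (h1 : 1 < γ) :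
    1 + ENNReal.ofReal (γ - 1) * hellSq P Q ≤ renyiIntegral γ P Q := by
  have hmain : ENNReal.ofReal γ + ENNReal.ofReal (γ - 1) * hellSq P Q
      ≤ renyiIntegral γ P Q + ENNReal.ofReal (γ - 1) := by
    have e1 : ENNReal.ofReal γ
        = ∫⁻ x, ENNReal.ofReal γ * ENNReal.ofReal (dens P (P + Q) x) ∂(P + Q) := by
      rw [lintegral_const_mul _ (by fun_prop), lintegral_dens (absolutelyContinuous_add_left P Q),
        mul_one]
    have e2 : ENNReal.ofReal (γ - 1)
        = ∫⁻ x, ENNReal.ofReal (γ - 1) * ENNReal.ofReal (dens Q (P + Q) x) ∂(P + Q) := by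
      rw [lintegral_const_mul _ (by fun_prop), lintegral_dens (absolutelyContinuous_add_right P Q),
        mul_one]
    conv_lhs => rw [e1]
    conv_rhs => rw [e2]
    unfold renyiIntegral hellSq
    rw [← lintegral_const_mul _ (by fun_prop), ← lintegral_add_right _ (by fun_prop),
      ← lintegral_add_right _ (by fun_prop)]
    refine lintegral_mono_ae ?_
    filter_upwards [Measure.rnDeriv_ne_top P (P + Q), Measure.rnDeriv_ne_top Q (P + Q)]
      with x hx hy
    have hp := dens_nonneg P (P + Q) x
    have hq := dens_nonneg Q (P + Q) x
    have hg : 0 ≤ γ - 1 := by linarith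
    rw [← ENNReal.ofReal_toReal hx, ← ENNReal.ofReal_toReal hy]
    change _ ≤ ENNReal.ofReal (dens P (P + Q) x) ^ γ *
      ENNReal.ofReal (dens Q (P + Q) x) ^ (1 - γ) + _
    generalize dens P (P + Q) x = p at *
    generalize dens Q (P + Q) x = q at *
    rcases hq.eq_or_lt with rfl | hq'
    · rcases hp.eq_or_lt with rfl | hp'
      · simp
      · rw [ENNReal.ofReal_zero, ENNReal.zero_rpow_of_neg (by linarith), ENNReal.mul_top]
        · simp
        · exact (ENNReal.rpow_pos (ENNReal.ofReal_pos.2 hp') ENNReal.ofReal_ne_top).ne'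
    · rw [ENNReal.ofReal_rpow_of_nonneg hp (by linarith), ENNReal.ofReal_rpow_of_pos hq',
        ← ENNReal.ofReal_mul (Real.rpow_nonneg hp _), ← ENNReal.ofReal_mul (by linarith),
        ← ENNReal.ofReal_mul hg, ← ENNReal.ofReal_mul hg,
        ← ENNReal.ofReal_add (mul_nonneg (by linarith) hp) (mul_nonneg hg (sq_nonneg _)),
        ← ENNReal.ofReal_add (mul_nonneg (Real.rpow_nonneg hp _) (Real.rpow_nonneg hq _))
          (mul_nonneg hg hq)]
      exact ENNReal.ofReal_le_ofReal (mul_add_le_rpow_mul_rpow_add h1 hp hq')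
  have e : ENNReal.ofReal γ = 1 + ENNReal.ofReal (γ - 1) := by
    rw [← ENNReal.ofReal_one, ← ENNReal.ofReal_add zero_le_one (by linarith)]; simp
  rw [e, add_right_comm] at hmain
  exact (ENNReal.add_le_add_iff_right ENNReal.ofReal_ne_top).1 hmain

lemma hellSq_le_klDiv : hellSq P Q ≤ InformationTheory.klDiv P Q := by
  by_cases hac : P ≪ Q
  swap
  · simp [InformationTheory.klDiv_of_not_ac hac]
  rw [InformationTheory.klDiv_eq_lintegral_klFun_of_ac hac,
    ← lintegral_dens_mul (absolutelyContinuous_add_right P Q)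
      (by have := InformationTheory.measurable_klFun; fun_prop)]
  refine lintegral_mono_ae ?_
  filter_upwards [Measure.rnDeriv_mul_rnDeriv (κ := P + Q) hac] with x hx
  have hx' : dens P (P + Q) x = dens P Q x * dens Q (P + Q) x := by
    rw [dens, dens, dens, ← hx, Pi.mul_apply, ENNReal.toReal_mul]
  have ht := dens_nonneg P Q x
  have hq := dens_nonneg Q (P + Q) x
  rw [hx', ← ENNReal.ofReal_mul hq]
  change _ ≤ ENNReal.ofReal (_ * InformationTheory.klFun (dens P Q x))
  refine ENNReal.ofReal_le_ofReal ?_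
  rw [Real.sqrt_mul ht]
  generalize dens P Q x = t at *
  generalize dens Q (P + Q) x = q at *
  have : (√t * √q - √q) ^ 2 = q * (√t - 1) ^ 2 := by
    nlinarith [Real.sq_sqrt hq]
  rw [this]
  refine mul_le_mul_of_nonneg_left ?_ hq
  rw [InformationTheory.klFun]
  rcases ht.eq_or_lt with rfl | ht'
  · simp
  -- `log √t ≥ 1 - 1 / √t`
  have hs := Real.sqrt_pos.2 ht'
  have hlog := Real.one_sub_inv_le_log_of_pos hs
  rw [Real.log_sqrt ht] at hlog
  have : t * (√t)⁻¹ = √t := by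
    field_simp; exact (Real.sq_sqrt ht).symm
  nlinarith [Real.sq_sqrt ht, mul_le_mul_of_nonneg_left hlog ht]

/-- A constant such that the squared Hellinger distance is at most this constant times the Rényi
divergence of order `γ`. It covers `(1 - γ) / min γ (1 - γ)` for `γ < 1` and `2 γ - 1` for `γ ≥ 1`,
which is what the refined Young inequalities give. -/
noncomputable def hellConst (γ : ℝ) : ℝ≥0 := (γ⁻¹ + 2 * γ).toNNReal

lemma hellSq_le_renyiDiv {γ : ℝ} (hγ : 0 < γ) : hellSq P Q ≤ hellConst γ * renyiDiv γ P Q := by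
  have hC : 0 < γ⁻¹ + 2 * γ := by positivity
  have hC0 : (hellConst γ : ℝ≥0∞) ≠ 0 := by
    simpa [hellConst] using hC
  have hinv : γ * γ⁻¹ = 1 := mul_inv_cancel₀ hγ.ne'
  have hinv0 : 0 < γ⁻¹ := inv_pos.2 hγ
  have hH2 := hellSq_le_two P Q
  have hHtop : hellSq P Q ≠ ∞ := (hH2.trans_lt (by simp)).ne
  obtain ⟨h, hh0, hh⟩ : ∃ h : ℝ, 0 ≤ h ∧ hellSq P Q = ENNReal.ofReal h :=
    ⟨_, ENNReal.toReal_nonneg, (ENNReal.ofReal_toReal hHtop).symm⟩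
  have hh2 : h ≤ 2 := by
    rw [hh] at hH2
    exact (ENNReal.ofReal_le_ofReal_iff (by norm_num)).1 (by simpa using hH2)
  -- it is enough to bound the divergence below when it is given by a finite positive integral
  have real_case : ∀ {i : ℝ}, 0 < i → renyiIntegral γ P Q = ENNReal.ofReal i → γ ≠ 1 →
      h ≤ (γ⁻¹ + 2 * γ) * ((γ - 1)⁻¹ * Real.log i) →
      hellSq P Q ≤ hellConst γ * renyiDiv γ P Q := by
    intro i hi hI h1 hle
    rw [renyiDiv, if_neg h1, hI, ENNReal.log_ofReal_of_pos hi, ← EReal.coe_mul,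
      EReal.toENNReal_of_ne_top (EReal.coe_ne_top _), EReal.toReal_coe, hh, hellConst]
    change _ ≤ ENNReal.ofReal _ * _
    rw [← ENNReal.ofReal_mul hC.le]
    exact ENNReal.ofReal_le_ofReal hle
  rcases lt_trichotomy γ 1 with h1 | rfl | h1
  · have hI := renyiIntegral_add_hellSq_le P Q hγ h1
    have hm : 0 ≤ min γ (1 - γ) := le_min hγ.le (by linarith)
    have hItop : renyiIntegral γ P Q ≠ ∞ :=
      ((le_self_add.trans hI).trans_lt ENNReal.one_lt_top).ne
    rcases eq_or_ne (renyiIntegral γ P Q) 0 with h0 | h0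
    · have : renyiDiv γ P Q = ∞ := by
        rw [renyiDiv, if_neg h1.ne, h0, ENNReal.log_zero,
          EReal.coe_mul_bot_of_neg (inv_lt_zero.2 (by linarith)), EReal.toENNReal_top]
      rw [this, ENNReal.mul_top hC0]
      exact le_top
    · have hi := ENNReal.toReal_pos h0 hItop
      refine real_case hi (ENNReal.ofReal_toReal hItop).symm h1.ne ?_
      rw [hh, ← ENNReal.ofReal_toReal hItop, ← ENNReal.ofReal_mul hm,
        ← ENNReal.ofReal_add hi.le (mul_nonneg hm hh0), ENNReal.ofReal_le_one] at hI
      have hlog := Real.log_le_sub_one_of_pos hi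
      have hg : 0 < 1 - γ := by linarith
      have e : (γ - 1)⁻¹ = -(1 - γ)⁻¹ := by rw [← inv_neg, neg_sub]
      have hmh : min γ (1 - γ) * h ≤ -Real.log (renyiIntegral γ P Q).toReal := by linarith
      have hc : 1 ≤ (γ⁻¹ + 2 * γ) * ((1 - γ)⁻¹ * min γ (1 - γ)) := by
        rw [mul_comm (1 - γ)⁻¹, ← mul_assoc, ← div_eq_mul_inv, le_div_iff₀ hg]
        have := one_lt_inv_iff₀.2 ⟨hγ, h1⟩
        rcases min_choice γ (1 - γ) with hmin | hmin <;> rw [hmin] <;> nlinarith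
      calc h ≤ (γ⁻¹ + 2 * γ) * ((1 - γ)⁻¹ * min γ (1 - γ)) * h := le_mul_of_one_le_left hh0 hc
        _ = (γ⁻¹ + 2 * γ) * (1 - γ)⁻¹ * (min γ (1 - γ) * h) := by ring
        _ ≤ (γ⁻¹ + 2 * γ) * (1 - γ)⁻¹ * -Real.log (renyiIntegral γ P Q).toReal := by gcongr
        _ = _ := by rw [e]; ring
  · rw [renyiDiv, if_pos rfl]
    refine (hellSq_le_klDiv P Q).trans (le_mul_of_one_le_left zero_le ?_)
    rw [hellConst]
    norm_num
  · have hI := one_add_hellSq_le_renyiIntegral P Q h1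
    have hg : 0 < γ - 1 := by linarith
    rcases eq_or_ne (renyiIntegral γ P Q) ∞ with htop | htop
    · have : renyiDiv γ P Q = ∞ := by
        rw [renyiDiv, if_neg h1.ne', htop, ENNReal.log_top,
          EReal.coe_mul_top_of_pos (inv_pos.2 hg), EReal.toENNReal_top]
      rw [this, ENNReal.mul_top hC0]
      exact le_top
    · have h0 : renyiIntegral γ P Q ≠ 0 :=
        (lt_of_lt_of_le one_pos (le_self_add.trans hI)).ne'
      have hi := ENNReal.toReal_pos h0 htop
      refine real_case hi (ENNReal.ofReal_toReal htop).symm h1.ne' ?_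
      rw [hh, ← ENNReal.ofReal_toReal htop, ← ENNReal.ofReal_mul hg.le, ← ENNReal.ofReal_one,
        ← ENNReal.ofReal_add zero_le_one (mul_nonneg hg.le hh0),
        ENNReal.ofReal_le_ofReal_iff hi.le] at hI
      -- `log (1 + t) ≥ t / (1 + t)` at `t = (γ - 1) h`, and `h ≤ 2`
      have ht : 0 ≤ (γ - 1) * h := mul_nonneg hg.le hh0
      have hlog := (Real.one_sub_inv_le_log_of_pos (by linarith : 0 < 1 + (γ - 1) * h)).trans
        (Real.log_le_log (by linarith) hI)
      have e : 1 - (1 + (γ - 1) * h)⁻¹ = (γ - 1) * h / (1 + (γ - 1) * h) := by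
        field_simp; ring
      rw [e, div_le_iff₀ (by linarith)] at hlog
      have hl0 : 0 ≤ Real.log (renyiIntegral γ P Q).toReal := Real.log_nonneg (by linarith)
      rw [← mul_assoc, ← div_eq_mul_inv, div_mul_eq_mul_div, le_div_iff₀ hg]
      nlinarith [mul_le_mul_of_nonneg_left hh2 (mul_nonneg hg.le hl0), mul_nonneg hinv0.le hl0]

end Hellinger

/-! ### Hellinger distance and product measures -/

section Tensor

variable {Ω : Type*} [MeasurableSpace Ω]

lemma lintegral_pi_prod (μ : Measure Ω) [IsFiniteMeasure μ] {n : ℕ}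
    {f : Fin n → Ω → ℝ≥0∞} (hf : ∀ i, Measurable (f i)) :
    ∫⁻ w, ∏ i, f i (w i) ∂(Measure.pi fun _ : Fin n => μ) = ∏ i, ∫⁻ x, f i x ∂μ := by
  induction n with
  | zero => simp
  | succ n ih =>
    rw [← ((measurePreserving_piFinSuccAbove (fun _ : Fin (n + 1) => μ) 0).symm).lintegral_comp
      (by fun_prop)]
    simp only [Fin.prod_univ_succ, MeasurableEquiv.piFinSuccAbove_symm_apply, Fin.insertNthEquiv,
      Equiv.coe_fn_mk, Fin.insertNth_zero', Fin.cons_zero, Fin.cons_succ]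
    have hf' : Measurable fun w : Fin n → Ω => ∏ i, f i.succ (w i) :=
      Finset.univ.measurable_fun_prod fun i _ => (hf i.succ).comp (measurable_pi_apply i)
    rw [← ih fun i => hf i.succ, ← lintegral_prod_mul (hf 0).aemeasurable hf'.aemeasurable]

lemma pi_withDensity (μ : Measure Ω) [IsFiniteMeasure μ]
    {f : Ω → ℝ≥0∞} (hf : Measurable f) [IsFiniteMeasure (μ.withDensity f)] (n : ℕ) :
    (Measure.pi fun _ : Fin n => μ).withDensity (fun w => ∏ i, f (w i))
      = Measure.pi fun _ : Fin n => μ.withDensity f := by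
  refine (Measure.pi_eq fun s hs => ?_).symm
  rw [withDensity_apply _ (.univ_pi hs), ← lintegral_indicator (.univ_pi hs)]
  have e : ∀ w : Fin n → Ω, (Set.univ.pi s).indicator (fun w => ∏ i, f (w i)) w
      = ∏ i, (s i).indicator f (w i) := by
    intro w
    by_cases hw : w ∈ Set.univ.pi s
    · rw [Set.indicator_of_mem hw]
      exact Finset.prod_congr rfl fun i _ => (Set.indicator_of_mem (hw i trivial) f).symm
    · rw [Set.indicator_of_notMem hw]
      obtain ⟨i, hi⟩ : ∃ i, w i ∉ s i := by simpa using hw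
      exact (Finset.prod_eq_zero (Finset.mem_univ i) (Set.indicator_of_notMem hi f)).symm
  simp_rw [e]
  rw [lintegral_pi_prod μ fun i => hf.indicator (hs i)]
  exact Finset.prod_congr rfl fun i _ => by
    rw [lintegral_indicator (hs i), withDensity_apply _ (hs i)]

variable (R S : Measure Ω) [IsProbabilityMeasure R] [IsProbabilityMeasure S]

/-- The squared Hellinger distance in terms of the Hellinger affinity `∫ √p √q`. -/
lemma hellSq_add_two_mul_affinity :
    hellSq R S + 2 * ∫⁻ x, ENNReal.ofReal (√(dens R (R + S) x) * √(dens S (R + S) x)) ∂(R + S)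
      = 2 := by
  rw [hellSq, ← lintegral_const_mul _ (by fun_prop), ← lintegral_add_left (by fun_prop)]
  trans ∫⁻ x, (ENNReal.ofReal (dens R (R + S) x) + ENNReal.ofReal (dens S (R + S) x)) ∂(R + S)
  · refine lintegral_congr fun x => ?_
    have hr := dens_nonneg R (R + S) x
    have hs := dens_nonneg S (R + S) x
    rw [← ENNReal.ofReal_add hr hs, ← ENNReal.ofReal_ofNat 2, ← ENNReal.ofReal_mul (by norm_num),
      ← ENNReal.ofReal_add (sq_nonneg _) (by positivity)]
    congr 1
    nlinarith [Real.sq_sqrt hr, Real.sq_sqrt hs]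
  · rw [lintegral_add_left (by fun_prop), lintegral_dens (absolutelyContinuous_add_left R S),
      lintegral_dens (absolutelyContinuous_add_right R S), one_add_one_eq_two]

/-- The expectations of a function with values in `[0, 1]` under the `n`-fold products of `R` and
`S` differ by at most `2 √(n H²)`, with `H` the Hellinger distance of `R` and `S`: the affinity is
multiplicative, and the Hellinger distance dominates the total variation distance. -/
lemma lintegral_pi_le_add_hellSq (n : ℕ) {ψ : (Fin n → Ω) → ℝ≥0∞} (hψ : Measurable ψ)
    (hψ1 : ∀ w, ψ w ≤ 1) :
    ∫⁻ w, ψ w ∂(Measure.pi fun _ : Fin n => R)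
      ≤ ∫⁻ w, ψ w ∂(Measure.pi fun _ : Fin n => S) + 2 * (n * hellSq R S) ^ (1 / 2 : ℝ) := by
  set μ := R + S with hμ
  set a : (Fin n → Ω) → ℝ := fun w => ∏ i, √(dens R μ (w i)) with ha
  set b : (Fin n → Ω) → ℝ := fun w => ∏ i, √(dens S μ (w i)) with hb
  have ha0 : ∀ w, 0 ≤ a w := fun w => Finset.prod_nonneg fun i _ => Real.sqrt_nonneg _
  have hb0 : ∀ w, 0 ≤ b w := fun w => Finset.prod_nonneg fun i _ => Real.sqrt_nonneg _
  have ham : Measurable a := by fun_prop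
  have hbm : Measurable b := by fun_prop
  have sq : ∀ (T : Measure Ω) (w : Fin n → Ω), ENNReal.ofReal ((∏ i, √(dens T μ (w i))) ^ 2)
      = ∏ i, ENNReal.ofReal (dens T μ (w i)) := by
    intro T w
    rw [← Finset.prod_pow, ENNReal.ofReal_prod_of_nonneg fun i _ => sq_nonneg _]
    exact Finset.prod_congr rfl fun i _ => by rw [Real.sq_sqrt (dens_nonneg _ _ _)]
  have hpi : ∀ (T : Measure Ω) [IsProbabilityMeasure T], T ≪ μ → ∀ {g : (Fin n → Ω) → ℝ≥0∞},
      Measurable g → ∫⁻ w, g w ∂(Measure.pi fun _ : Fin n => T)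
        = ∫⁻ w, ENNReal.ofReal ((∏ i, √(dens T μ (w i))) ^ 2) * g w
          ∂(Measure.pi fun _ : Fin n => μ) := by
    intro T _ hT g hg
    have : IsFiniteMeasure (μ.withDensity fun x => ENNReal.ofReal (dens T μ x)) := by
      rw [withDensity_dens hT]; infer_instance
    conv_lhs => rw [← withDensity_dens hT]
    rw [← pi_withDensity μ (by fun_prop) n,
      lintegral_withDensity_eq_lintegral_mul _ (by fun_prop) hg]
    exact lintegral_congr fun w => by rw [Pi.mul_apply, sq T w]
  have hRac : R ≪ μ := absolutelyContinuous_add_left R S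
  have hSac : S ≪ μ := absolutelyContinuous_add_right R S
  set ν := Measure.pi fun _ : Fin n => μ with hν
  have ha1 : ∫⁻ w, ENNReal.ofReal (a w ^ 2) ∂ν = 1 := by
    have := hpi R hRac (g := fun _ => 1) measurable_const
    simpa using this.symm
  have hb1 : ∫⁻ w, ENNReal.ofReal (b w ^ 2) ∂ν = 1 := by
    have := hpi S hSac (g := fun _ => 1) measurable_const
    simpa using this.symm
  -- the Hellinger distance of the products
  have hH : ∫⁻ w, ENNReal.ofReal (|a w - b w| ^ 2) ∂ν ≤ n * hellSq R S := by
    set c := ∫⁻ x, ENNReal.ofReal (√(dens R μ x) * √(dens S μ x)) ∂μ with hc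
    have h1 : hellSq R S + 2 * c = 2 := hellSq_add_two_mul_affinity R S
    have h2 : ∫⁻ w, ENNReal.ofReal (|a w - b w| ^ 2) ∂ν + 2 * c ^ n = 2 := by
      have hab : ∫⁻ w, ENNReal.ofReal (a w * b w) ∂ν = c ^ n := by
        have := lintegral_pi_prod μ (n := n)
          (f := fun _ x => ENNReal.ofReal (√(dens R μ x) * √(dens S μ x))) fun _ => by fun_prop
        rw [Finset.prod_const, Finset.card_univ, Fintype.card_fin] at this
        rw [← this]
        refine lintegral_congr fun w => ?_
        rw [ha, hb, ← ENNReal.ofReal_prod_of_nonneg fun i _ => by positivity,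
          Finset.prod_mul_distrib]
      rw [← hab, ← lintegral_const_mul _ (by fun_prop), ← lintegral_add_left (by fun_prop)]
      trans ∫⁻ w, (ENNReal.ofReal (a w ^ 2) + ENNReal.ofReal (b w ^ 2)) ∂ν
      swap
      · rw [lintegral_add_left (by fun_prop), ha1, hb1, one_add_one_eq_two]
      refine lintegral_congr fun w => ?_
      rw [← ENNReal.ofReal_add (sq_nonneg _) (sq_nonneg _), ← ENNReal.ofReal_ofNat 2,
        ← ENNReal.ofReal_mul (by norm_num), ← ENNReal.ofReal_add (sq_nonneg _)
          (mul_nonneg (by norm_num) (mul_nonneg (ha0 w) (hb0 w))), sq_abs]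
      congr 1
      ring
    have hctop : c ≠ ∞ := by
      intro h
      rw [h] at h1
      simp at h1
    have hHtop : hellSq R S ≠ ∞ := ((hellSq_le_two R S).trans_lt (by simp)).ne
    have hItop : ∫⁻ w, ENNReal.ofReal (|a w - b w| ^ 2) ∂ν ≠ ∞ :=
      ((le_self_add.trans h2.le).trans_lt (by simp)).ne
    have r1 := congrArg ENNReal.toReal h1
    have r2 := congrArg ENNReal.toReal h2
    rw [ENNReal.toReal_add hHtop (by finiteness), ENNReal.toReal_mul] at r1
    rw [ENNReal.toReal_add hItop (by finiteness), ENNReal.toReal_mul, ENNReal.toReal_pow] at r2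
    simp only [ENNReal.toReal_ofNat] at r1 r2
    rw [← ENNReal.toReal_le_toReal hItop (by finiteness), ENNReal.toReal_mul,
      ENNReal.toReal_natCast]
    have hc0 : 0 ≤ c.toReal := ENNReal.toReal_nonneg
    -- Bernoulli's inequality
    have := one_add_mul_le_pow (a := c.toReal - 1) (by linarith) n
    rw [add_sub_cancel] at this
    nlinarith
  have hS4 : ∫⁻ w, ENNReal.ofReal ((a w + b w) ^ 2) ∂ν ≤ 4 := by
    calc _ ≤ ∫⁻ w, (2 * ENNReal.ofReal (a w ^ 2) + 2 * ENNReal.ofReal (b w ^ 2)) ∂ν := by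
          refine lintegral_mono fun w => ?_
          rw [← ENNReal.ofReal_ofNat 2, ← ENNReal.ofReal_mul (by norm_num),
            ← ENNReal.ofReal_mul (by norm_num), ← ENNReal.ofReal_add (by positivity)
              (by positivity)]
          exact ENNReal.ofReal_le_ofReal (by nlinarith [sq_nonneg (a w - b w)])
      _ = 4 := by
          rw [lintegral_add_left (by fun_prop), lintegral_const_mul _ (by fun_prop),
            lintegral_const_mul _ (by fun_prop), ha1, hb1]
          norm_num
  have pow2 : ∀ {x : ℝ}, 0 ≤ x → ENNReal.ofReal (x ^ 2) = ENNReal.ofReal x ^ (2 : ℝ) := by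
    intro x hx
    rw [ENNReal.ofReal_pow hx]; norm_cast
  -- `a ^ 2 - b ^ 2 = (a - b) (a + b)` and the Cauchy-Schwarz inequality
  have hCS : ∫⁻ w, ENNReal.ofReal |a w - b w| * ENNReal.ofReal (a w + b w) ∂ν
      ≤ (n * hellSq R S) ^ (1 / 2 : ℝ) * 2 := by
    refine (ENNReal.lintegral_mul_le_Lp_mul_Lq ν (p := 2) (q := 2) (by constructor <;> norm_num)
      (by fun_prop) (by fun_prop)).trans ?_
    simp_rw [← pow2 (abs_nonneg _), ← pow2 (add_nonneg (ha0 _) (hb0 _))]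
    have e4 : (4 : ℝ≥0∞) ^ (1 / 2 : ℝ) = 2 := by
      rw [show (4 : ℝ≥0∞) = 2 ^ (2 : ℝ) by norm_num, ← ENNReal.rpow_mul]; norm_num
    rw [← e4]
    gcongr
  rw [hpi R hRac hψ, hpi S hSac hψ, mul_comm 2]
  refine le_trans ?_ (add_le_add_right hCS _)
  rw [← lintegral_add_left (by fun_prop)]
  refine lintegral_mono fun w => ?_
  change ENNReal.ofReal (a w ^ 2) * ψ w ≤ ENNReal.ofReal (b w ^ 2) * ψ w + _
  have h3 : ENNReal.ofReal (a w ^ 2)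
      ≤ ENNReal.ofReal (b w ^ 2) + ENNReal.ofReal |a w - b w| * ENNReal.ofReal (a w + b w) := by
    rw [← ENNReal.ofReal_mul (abs_nonneg _), ← ENNReal.ofReal_add (sq_nonneg _)
      (mul_nonneg (abs_nonneg _) (add_nonneg (ha0 w) (hb0 w)))]
    refine ENNReal.ofReal_le_ofReal ?_
    nlinarith [mul_le_mul_of_nonneg_right (le_abs_self (a w - b w)) (add_nonneg (ha0 w) (hb0 w))]
  calc ENNReal.ofReal (a w ^ 2) * ψ w
      ≤ (ENNReal.ofReal (b w ^ 2)
        + ENNReal.ofReal |a w - b w| * ENNReal.ofReal (a w + b w)) * ψ w := by gcongr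
    _ ≤ _ := by
        rw [add_mul]
        exact add_le_add le_rfl (mul_le_of_le_one_right zero_le (hψ1 w))

end Tensor

/-! ### The effect of pairing two families of distributions -/

section Bilinear

variable {𝓧 𝓨 : Type*} [MeasurableSpace 𝓧] [MeasurableSpace 𝓨]

lemma lintegral_prod_dens {P μ : Measure 𝓧} {Q ν : Measure 𝓨} [IsFiniteMeasure P]
    [IsFiniteMeasure μ] [IsFiniteMeasure Q] [IsFiniteMeasure ν] (hP : P ≪ μ) (hQ : Q ≪ ν)
    {f : 𝓧 × 𝓨 → ℝ≥0∞} (hf : Measurable f) :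
    ∫⁻ w, f w ∂(P.prod Q)
      = ∫⁻ w, ENNReal.ofReal (dens P μ w.1 * dens Q ν w.2) * f w ∂(μ.prod ν) := by
  conv_lhs => rw [← withDensity_dens hP, ← withDensity_dens hQ]
  have h1 : IsFiniteMeasure (μ.withDensity fun x => ENNReal.ofReal (dens P μ x)) := by
    rw [withDensity_dens hP]; infer_instance
  have h2 : IsFiniteMeasure (ν.withDensity fun x => ENNReal.ofReal (dens Q ν x)) := by
    rw [withDensity_dens hQ]; infer_instance
  rw [prod_withDensity (by fun_prop) (by fun_prop),
    lintegral_withDensity_eq_lintegral_mul _ (by fun_prop) hf]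
  refine lintegral_congr fun w => ?_
  rw [Pi.mul_apply, ENNReal.ofReal_mul (dens_nonneg _ _ _)]

/-- The pointwise form of `lintegral_prod_add_le`, in which `p`, `p'`, `q`, `q'` are densities. It
says that `2 (2 ρ - 1) (p - p') (q - q')` is at most
`4 (√p - √p') ^ 2 (√q - √q') ^ 2 + (2 ρ - 1) ^ 2 (p + p') (q + q')`. -/
lemma density_cross_le {p p' q q' ρ : ℝ} (hp : 0 ≤ p) (hp' : 0 ≤ p') (hq : 0 ≤ q)
    (hq' : 0 ≤ q') :
    p * q * (4 * ρ) + p' * q' * (4 * ρ) + p * q' * 2 + p' * q * 2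
      ≤ 4 * ((√p - √p') ^ 2 * (√q - √q') ^ 2) + (p * q * (2 * ρ - 1) ^ 2
        + p' * q' * (2 * ρ - 1) ^ 2 + p * q' * (2 * ρ - 1) ^ 2 + p' * q * (2 * ρ - 1) ^ 2)
        + p * q' * (4 * ρ) + p' * q * (4 * ρ) + p * q * 2 + p' * q' * 2 := by
  obtain ⟨a, ha, rfl⟩ : ∃ a, 0 ≤ a ∧ p = a ^ 2 := ⟨√p, Real.sqrt_nonneg _, (Real.sq_sqrt hp).symm⟩
  obtain ⟨b, hb, rfl⟩ : ∃ b, 0 ≤ b ∧ p' = b ^ 2 :=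
    ⟨√p', Real.sqrt_nonneg _, (Real.sq_sqrt hp').symm⟩
  obtain ⟨c, hc, rfl⟩ : ∃ c, 0 ≤ c ∧ q = c ^ 2 := ⟨√q, Real.sqrt_nonneg _, (Real.sq_sqrt hq).symm⟩
  obtain ⟨d, hd, rfl⟩ : ∃ d, 0 ≤ d ∧ q' = d ^ 2 :=
    ⟨√q', Real.sqrt_nonneg _, (Real.sq_sqrt hq').symm⟩
  rw [Real.sqrt_sq ha, Real.sqrt_sq hb, Real.sqrt_sq hc, Real.sqrt_sq hd]
  -- `2 u v U V g ≤ 4 u ^ 2 v ^ 2 + U ^ 2 V ^ 2 g ^ 2 / 4`, for `u = a - b`, `U = a + b` and so on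
  have h1 := sq_nonneg (2 * ((a - b) * (c - d)) - (a + b) * (c + d) * (2 * ρ - 1) / 2)
  have hU : (a + b) ^ 2 * (c + d) ^ 2 ≤ (2 * (a ^ 2 + b ^ 2)) * (2 * (c ^ 2 + d ^ 2)) :=
    mul_le_mul (by nlinarith [sq_nonneg (a - b)]) (by nlinarith [sq_nonneg (c - d)])
      (sq_nonneg _) (by positivity)
  have h2 := mul_le_mul_of_nonneg_right hU (sq_nonneg (2 * ρ - 1))
  linarith

variable (P P' : Measure 𝓧) (Q Q' : Measure 𝓨) [IsProbabilityMeasure P] [IsProbabilityMeasure P']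
  [IsProbabilityMeasure Q] [IsProbabilityMeasure Q']

/-- The signed measure `(P - P') ⊗ (Q - Q')` is small, in terms of the product of the squared
Hellinger distances: this is where the two Lipschitz conditions multiply. Terms with a
negative sign are moved to the other side. -/
lemma lintegral_prod_add_le {ρ : 𝓧 × 𝓨 → ℝ} (hρ : Measurable ρ) (hρ0 : ∀ w, 0 ≤ ρ w) :
    4 * ∫⁻ w, ENNReal.ofReal (ρ w) ∂(P.prod Q) + 4 * ∫⁻ w, ENNReal.ofReal (ρ w) ∂(P'.prod Q')
      ≤ 4 * (hellSq P P' * hellSq Q Q')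
        + (∫⁻ w, ENNReal.ofReal ((2 * ρ w - 1) ^ 2) ∂(P.prod Q)
          + ∫⁻ w, ENNReal.ofReal ((2 * ρ w - 1) ^ 2) ∂(P'.prod Q')
          + ∫⁻ w, ENNReal.ofReal ((2 * ρ w - 1) ^ 2) ∂(P.prod Q')
          + ∫⁻ w, ENNReal.ofReal ((2 * ρ w - 1) ^ 2) ∂(P'.prod Q))
        + 4 * ∫⁻ w, ENNReal.ofReal (ρ w) ∂(P.prod Q')
        + 4 * ∫⁻ w, ENNReal.ofReal (ρ w) ∂(P'.prod Q) := by
  have hP := absolutelyContinuous_add_left P P'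
  have hP' := absolutelyContinuous_add_right P P'
  have hQ := absolutelyContinuous_add_left Q Q'
  have hQ' := absolutelyContinuous_add_right Q Q'
  have four : ∀ (m : Measure (𝓧 × 𝓨)), 4 * ∫⁻ w, ENNReal.ofReal (ρ w) ∂m
      = ∫⁻ w, ENNReal.ofReal (4 * ρ w) ∂m := fun m => by
    rw [← lintegral_const_mul _ (by fun_prop)]
    refine lintegral_congr fun w => ?_
    rw [ENNReal.ofReal_mul (by norm_num), ENNReal.ofReal_ofNat]
  have two : ∀ (m : Measure (𝓧 × 𝓨)) [IsProbabilityMeasure m], ∫⁻ _, ENNReal.ofReal 2 ∂m = 2 :=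
    fun m _ => by simp
  have hH : 4 * (hellSq P P' * hellSq Q Q') = ∫⁻ w, ENNReal.ofReal
      (4 * ((√(dens P (P + P') w.1) - √(dens P' (P + P') w.1)) ^ 2 *
        (√(dens Q (Q + Q') w.2) - √(dens Q' (Q + Q') w.2)) ^ 2)) ∂((P + P').prod (Q + Q')) := by
    rw [hellSq, hellSq, ← lintegral_prod_mul (by fun_prop) (by fun_prop),
      ← lintegral_const_mul _ (by fun_prop)]
    refine lintegral_congr fun w => ?_
    rw [ENNReal.ofReal_mul (by norm_num), ENNReal.ofReal_ofNat, ENNReal.ofReal_mul (sq_nonneg _)]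
  -- `(P - P') ⊗ (Q - Q')` has total mass zero, so constants can be added to the test function
  refine (ENNReal.add_le_add_iff_right (a := 2 + 2) (by finiteness)).1 ?_
  rw [← add_assoc, ← add_assoc]
  nth_rw 1 [← two (P.prod Q')]
  nth_rw 1 [← two (P'.prod Q)]
  nth_rw 2 [← two (P.prod Q)]
  nth_rw 1 [← two (P'.prod Q')]
  simp only [four]
  rw [hH]
  repeat rw [lintegral_prod_dens hP hQ (by fun_prop)]
  repeat rw [lintegral_prod_dens hP hQ' (by fun_prop)]
  repeat rw [lintegral_prod_dens hP' hQ (by fun_prop)]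
  repeat rw [lintegral_prod_dens hP' hQ' (by fun_prop)]
  repeat rw [← lintegral_add_left (by fun_prop)]
  refine lintegral_mono fun w => ?_
  have hp := dens_nonneg P (P + P') w.1
  have hp' := dens_nonneg P' (P + P') w.1
  have hq := dens_nonneg Q (Q + Q') w.2
  have hq' := dens_nonneg Q' (Q + Q') w.2
  have hr := hρ0 w
  dsimp only
  generalize dens P (P + P') w.1 = p at *
  generalize dens P' (P + P') w.1 = p' at *
  generalize dens Q (Q + Q') w.2 = q at *
  generalize dens Q' (Q + Q') w.2 = q' at *
  generalize ρ w = r at *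
  have key := density_cross_le (ρ := r) hp hp' hq hq'
  repeat rw [← ENNReal.ofReal_mul (by positivity)]
  repeat rw [← ENNReal.ofReal_add (by positivity) (by positivity)]
  exact ENNReal.ofReal_le_ofReal (by linarith)

end Bilinear

/-! ### A variational bound for the Hellinger distance -/

section Variational

variable {Ω : Type*} [MeasurableSpace Ω] (R S : Measure Ω) [IsProbabilityMeasure R]
  [IsProbabilityMeasure S]

lemma dens_add_dens : ∀ᵐ x ∂(R + S), dens R (R + S) x + dens S (R + S) x = 1 := by
  filter_upwards [Measure.rnDeriv_add' R S (R + S), Measure.rnDeriv_self (R + S),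
    Measure.rnDeriv_ne_top R (R + S), Measure.rnDeriv_ne_top S (R + S)] with x h1 h2 h3 h4
  rw [dens, dens, ← ENNReal.toReal_add h3 h4, ← Pi.add_apply, ← h1, h2]
  simp

/-- A variational bound for the squared Hellinger distance, which needs no formula for the
densities: the inequality is used for the density `ρ` of `R` with respect to `R + S`, for which
`2 ρ - 1` is the difference of the two densities. -/
lemma hellSq_le_of_forall_lintegral_le {c : ℝ≥0∞}
    (h : ∀ ρ : Ω → ℝ, Measurable ρ → (∀ w, 0 ≤ ρ w) →
      8 * ∫⁻ w, ENNReal.ofReal (ρ w) ∂(R) ≤ 4 * c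
        + 2 * (∫⁻ w, ENNReal.ofReal ((2 * ρ w - 1) ^ 2) ∂(R)
          + ∫⁻ w, ENNReal.ofReal ((2 * ρ w - 1) ^ 2) ∂S)
        + 8 * ∫⁻ w, ENNReal.ofReal (ρ w) ∂S) :
    hellSq R S ≤ 2 * c := by
  have hR := absolutelyContinuous_add_left R S
  have hS := absolutelyContinuous_add_right R S
  have hρ := h (dens R (R + S)) (measurable_dens _ _) (dens_nonneg _ _)
  have hsum := dens_add_dens R S
  rw [← lintegral_add_measure] at hρ
  set D := ∫⁻ w, ENNReal.ofReal ((2 * dens R (R + S) w - 1) ^ 2) ∂(R + S) with hD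
  set A := ∫⁻ w, ENNReal.ofReal (dens R (R + S) w) ∂(R) with hA
  set B := ∫⁻ w, ENNReal.ofReal (dens R (R + S) w) ∂S with hB
  have hA' : A = ∫⁻ w, ENNReal.ofReal (dens R (R + S) w * dens R (R + S) w) ∂(R + S) := by
    rw [hA, ← lintegral_dens_mul hR (by fun_prop)]
    exact lintegral_congr fun w => (ENNReal.ofReal_mul (dens_nonneg _ _ _)).symm
  have hB' : B = ∫⁻ w, ENNReal.ofReal (dens S (R + S) w * dens R (R + S) w) ∂(R + S) := by
    rw [hB, ← lintegral_dens_mul hS (by fun_prop)]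
    exact lintegral_congr fun w => (ENNReal.ofReal_mul (dens_nonneg _ _ _)).symm
  have hle : ∀ (T : Measure Ω) [IsProbabilityMeasure T], T ≪ R + S →
      ∫⁻ w, ENNReal.ofReal (dens R (R + S) w) ∂T ≤ 1 := by
    intro T _ hT
    calc _ ≤ ∫⁻ _, 1 ∂T := by
          refine lintegral_mono_ae ?_
          filter_upwards [hT hsum] with w hw
          rw [ENNReal.ofReal_le_one]
          linarith [dens_nonneg S (R + S) w]
      _ = 1 := by simp
  have hAtop : A ≠ ∞ := ((hle R hR).trans_lt ENNReal.one_lt_top).ne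
  have hBtop : B ≠ ∞ := ((hle S hS).trans_lt ENNReal.one_lt_top).ne
  -- with `r + s = 1`, `(r - s) ^ 2 + 2 s r + r = 2 r ^ 2 + s`
  have hDAB : D + 2 * B = 2 * A := by
    refine (ENNReal.add_left_inj (a := 1) (by finiteness)).1 ?_
    nth_rw 1 [← lintegral_dens hR]
    rw [← lintegral_dens hS, hA', hB', hD, ← lintegral_const_mul _ (by fun_prop),
      ← lintegral_const_mul _ (by fun_prop), ← lintegral_add_left (by fun_prop),
      ← lintegral_add_left (by fun_prop), ← lintegral_add_left (by fun_prop)]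
    refine lintegral_congr_ae ?_
    filter_upwards [hsum] with w hw
    have hr := dens_nonneg R (R + S) w
    have hs := dens_nonneg S (R + S) w
    have two : (2 : ℝ≥0∞) = ENNReal.ofReal 2 := by simp
    rw [two, ← ENNReal.ofReal_mul (by norm_num), ← ENNReal.ofReal_mul (by norm_num),
      ← ENNReal.ofReal_add (by positivity) (by positivity),
      ← ENNReal.ofReal_add (by positivity) hr,
      ← ENNReal.ofReal_add (by positivity) hs]
    congr 1
    rw [← eq_sub_iff_add_eq'] at hw
    rw [hw]; ring
  have hDtop : D ≠ ∞ := by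
    have : D ≤ 2 * A := hDAB ▸ le_self_add
    exact (this.trans_lt (by finiteness)).ne
  have hDc : D ≤ 2 * c := by
    rcases eq_or_ne c ∞ with rfl | hc
    · simp
    have e : (8 : ℝ≥0∞) * A = 4 * D + 8 * B := by
      rw [show (8 : ℝ≥0∞) = 4 * 2 by norm_num, mul_assoc, ← hDAB]; ring
    rw [e] at hρ
    have hρ' := (ENNReal.add_le_add_iff_right (by finiteness)).1 hρ
    rw [← ENNReal.toReal_le_toReal hDtop (by finiteness)]
    rw [← ENNReal.toReal_le_toReal (by finiteness) (by finiteness),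
      ENNReal.toReal_add (by finiteness) (by finiteness)] at hρ'
    simp only [ENNReal.toReal_mul, ENNReal.toReal_ofNat] at hρ' ⊢
    linarith
  refine le_trans ?_ hDc
  refine lintegral_mono_ae ?_
  filter_upwards [hsum] with w hw
  have hr := dens_nonneg R (R + S) w
  have hs := dens_nonneg S (R + S) w
  refine ENNReal.ofReal_le_ofReal ?_
  rw [← eq_sub_iff_add_eq'] at hw
  have e : 2 * dens R (R + S) w - 1 = (√(dens R (R + S) w) - √(dens S (R + S) w))
      * (√(dens R (R + S) w) + √(dens S (R + S) w)) := by
    nlinarith [Real.sq_sqrt hr, Real.sq_sqrt hs]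
  rw [e, mul_pow]
  refine le_mul_of_one_le_right (sq_nonneg _) ?_
  nlinarith [Real.sq_sqrt hr, Real.sq_sqrt hs,
    mul_nonneg (Real.sqrt_nonneg (dens R (R + S) w)) (Real.sqrt_nonneg (dens S (R + S) w))]

end Variational

/-! ### Mixtures of products and products of mixtures -/

section Mixture

variable {𝓧 𝓨 𝓩 : Type*} [MeasurableSpace 𝓧] [MeasurableSpace 𝓨] [MeasurableSpace 𝓩]
  (κX : Kernel 𝓩 𝓧) (κY : Kernel 𝓩 𝓨) [IsMarkovKernel κX] [IsMarkovKernel κY]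

lemma comp_prod_comp (lam : Measure 𝓩) [IsFiniteMeasure lam] :
    (κX ∘ₘ lam).prod (κY ∘ₘ lam) = (κX ∥ₖ κY) ∘ₘ (lam.prod lam) := by
  rw [Measure.prod_comp_left, Measure.prod_comp_right, Measure.comp_assoc,
    Kernel.parallelComp_comp_parallelComp, Kernel.comp_id, Kernel.id_comp]

/-- The mixture of the products `κX z ⊗ κY z` is compared with the product of the mixtures, for
the mixing measure `lam`. With two independent copies `z`, `z'` of the mixing variable, the
difference of the two is the average of `(κX z - κX z') ⊗ (κY z - κY z') / 2`. -/
lemma lintegral_mixture_le (lam : Measure 𝓩) [IsFiniteMeasure lam] {e : ℝ≥0∞} {b : Set 𝓩}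
    (hb : ∀ᵐ z ∂lam, z ∈ b)
    (hX : ∀ z ∈ b, ∀ z' ∈ b, hellSq (κX z) (κX z') ≤ e)
    (hY : ∀ z ∈ b, ∀ z' ∈ b, hellSq (κY z) (κY z') ≤ e)
    {ρ : 𝓧 × 𝓨 → ℝ} (hρ : Measurable ρ) (hρ0 : ∀ w, 0 ≤ ρ w) :
    8 * (lam Set.univ * ∫⁻ w, ENNReal.ofReal (ρ w) ∂((κX ×ₖ κY) ∘ₘ lam))
      ≤ 4 * (lam Set.univ ^ 2 * e ^ 2)
        + 2 * (lam Set.univ * ∫⁻ w, ENNReal.ofReal ((2 * ρ w - 1) ^ 2) ∂((κX ×ₖ κY) ∘ₘ lam)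
          + ∫⁻ w, ENNReal.ofReal ((2 * ρ w - 1) ^ 2) ∂((κX ∘ₘ lam).prod (κY ∘ₘ lam)))
        + 8 * ∫⁻ w, ENNReal.ofReal (ρ w) ∂((κX ∘ₘ lam).prod (κY ∘ₘ lam)) := by
  have hm : ∀ {F : 𝓧 × 𝓨 → ℝ≥0∞}, Measurable F → ∀ {i j : 𝓩 × 𝓩 → 𝓩}, Measurable i →
      Measurable j → Measurable fun z : 𝓩 × 𝓩 => ∫⁻ w, F w ∂((κX (i z)).prod (κY (j z))) := by
    intro F hF i j hi hj
    have := (hF.lintegral_kernel (κ := κX ∥ₖ κY)).comp (hi.prodMk hj)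
    simpa only [Function.comp_def, Kernel.parallelComp_apply] using this
  have diag : ∀ {F : 𝓧 × 𝓨 → ℝ≥0∞}, Measurable F →
      ∫⁻ z : 𝓩 × 𝓩, ∫⁻ w, F w ∂((κX z.1).prod (κY z.1)) ∂(lam.prod lam)
        = lam Set.univ * ∫⁻ w, F w ∂((κX ×ₖ κY) ∘ₘ lam) := by
    intro F hF
    have hF' : Measurable fun z => ∫⁻ w, F w ∂((κX z).prod (κY z)) := by
      have := hF.lintegral_kernel (κ := κX ×ₖ κY)
      simpa only [Kernel.prod_apply] using this
    rw [lintegral_prod _ (hm hF measurable_fst measurable_fst).aemeasurable,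
      Measure.lintegral_bind (Kernel.aemeasurable _) hF.aemeasurable]
    simp only [lintegral_const, Kernel.prod_apply]
    rw [lintegral_mul_const _ hF', mul_comm]
  have diag' : ∀ {F : 𝓧 × 𝓨 → ℝ≥0∞}, Measurable F →
      ∫⁻ z : 𝓩 × 𝓩, ∫⁻ w, F w ∂((κX z.2).prod (κY z.2)) ∂(lam.prod lam)
        = lam Set.univ * ∫⁻ w, F w ∂((κX ×ₖ κY) ∘ₘ lam) := fun {F} hF => by
    rw [← diag hF, ← lintegral_prod_swap]
    rfl
  have cross : ∀ {F : 𝓧 × 𝓨 → ℝ≥0∞}, Measurable F →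
      ∫⁻ z : 𝓩 × 𝓩, ∫⁻ w, F w ∂((κX z.1).prod (κY z.2)) ∂(lam.prod lam)
        = ∫⁻ w, F w ∂((κX ∘ₘ lam).prod (κY ∘ₘ lam)) := by
    intro F hF
    rw [comp_prod_comp, Measure.lintegral_bind (Kernel.aemeasurable _) hF.aemeasurable]
    simp only [Kernel.parallelComp_apply]
  have cross' : ∀ {F : 𝓧 × 𝓨 → ℝ≥0∞}, Measurable F →
      ∫⁻ z : 𝓩 × 𝓩, ∫⁻ w, F w ∂((κX z.2).prod (κY z.1)) ∂(lam.prod lam)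
        = ∫⁻ w, F w ∂((κX ∘ₘ lam).prod (κY ∘ₘ lam)) := fun {F} hF => by
    rw [← cross hF, ← lintegral_prod_swap]
    rfl
  have hint : ∫⁻ z : 𝓩 × 𝓩, (4 * ∫⁻ w, ENNReal.ofReal (ρ w) ∂((κX z.1).prod (κY z.1))
      + 4 * ∫⁻ w, ENNReal.ofReal (ρ w) ∂((κX z.2).prod (κY z.2))) ∂(lam.prod lam)
      ≤ ∫⁻ z : 𝓩 × 𝓩, (4 * e ^ 2
        + (∫⁻ w, ENNReal.ofReal ((2 * ρ w - 1) ^ 2) ∂((κX z.1).prod (κY z.1))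
          + ∫⁻ w, ENNReal.ofReal ((2 * ρ w - 1) ^ 2) ∂((κX z.2).prod (κY z.2))
          + ∫⁻ w, ENNReal.ofReal ((2 * ρ w - 1) ^ 2) ∂((κX z.1).prod (κY z.2))
          + ∫⁻ w, ENNReal.ofReal ((2 * ρ w - 1) ^ 2) ∂((κX z.2).prod (κY z.1)))
        + 4 * ∫⁻ w, ENNReal.ofReal (ρ w) ∂((κX z.1).prod (κY z.2))
        + 4 * ∫⁻ w, ENNReal.ofReal (ρ w) ∂((κX z.2).prod (κY z.1))) ∂(lam.prod lam) := by
    refine lintegral_mono_ae ?_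
    have h1 : ∀ᵐ z : 𝓩 × 𝓩 ∂(lam.prod lam), z.1 ∈ b := Measure.quasiMeasurePreserving_fst.ae hb
    have h2 : ∀ᵐ z : 𝓩 × 𝓩 ∂(lam.prod lam), z.2 ∈ b := Measure.quasiMeasurePreserving_snd.ae hb
    filter_upwards [h1, h2] with z hz1 hz2
    refine (lintegral_prod_add_le (κX z.1) (κX z.2) (κY z.1) (κY z.2) hρ hρ0).trans ?_
    gcongr
    rw [sq]
    exact mul_le_mul' (hX _ hz1 _ hz2) (hY _ hz1 _ hz2)
  have m1 := fun {F : 𝓧 × 𝓨 → ℝ≥0∞} (hF : Measurable F) =>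
    hm hF (i := Prod.fst) (j := Prod.fst) measurable_fst measurable_fst
  have m2 := fun {F : 𝓧 × 𝓨 → ℝ≥0∞} (hF : Measurable F) =>
    hm hF (i := Prod.snd) (j := Prod.snd) measurable_snd measurable_snd
  have m3 := fun {F : 𝓧 × 𝓨 → ℝ≥0∞} (hF : Measurable F) =>
    hm hF (i := Prod.fst) (j := Prod.snd) measurable_fst measurable_snd
  have m4 := fun {F : 𝓧 × 𝓨 → ℝ≥0∞} (hF : Measurable F) =>
    hm hF (i := Prod.snd) (j := Prod.fst) measurable_snd measurable_fst
  have r1 : Measurable fun w => ENNReal.ofReal (ρ w) := by fun_prop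
  have r2 : Measurable fun w => ENNReal.ofReal ((2 * ρ w - 1) ^ 2) := by fun_prop
  have a1 := m1 r1
  have a2 := m2 r1
  have a3 := m3 r1
  have a4 := m4 r1
  have b1 := m1 r2
  have b2 := m2 r2
  have b3 := m3 r2
  have b4 := m4 r2
  rw [lintegral_add_left (by fun_prop), lintegral_add_right _ (by fun_prop),
    lintegral_add_right _ (by fun_prop), lintegral_add_right _ (by fun_prop),
    lintegral_add_right _ (by fun_prop), lintegral_add_right _ (by fun_prop),
    lintegral_add_right _ (by fun_prop), lintegral_const, lintegral_const_mul _ a1,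
    lintegral_const_mul _ a2, lintegral_const_mul _ a3, lintegral_const_mul _ a4,
    diag r1, diag r2, diag' r1, diag' r2, cross r1, cross r2, cross' r1, cross' r2,
    ← Set.univ_prod_univ, Measure.prod_prod] at hint
  convert hint using 1 <;> ring

end Mixture

/-! ### The binned law and its conditionally independent approximation -/

section Binned

variable {𝓧 𝓨 𝓩 : Type*} [MeasurableSpace 𝓧] [MeasurableSpace 𝓨] [MeasurableSpace 𝓩]

/-- Attach the label `m` to a pair. -/
def attachLabel {M : ℕ} (m : Fin M) (w : 𝓧 × 𝓨) : 𝓧 × 𝓨 × Fin M := (w.1, w.2, m)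

@[fun_prop]
lemma measurable_attachLabel {M : ℕ} (m : Fin M) :
    Measurable (attachLabel m : 𝓧 × 𝓨 → 𝓧 × 𝓨 × Fin M) := by
  unfold attachLabel; fun_prop

variable (κX : Kernel 𝓩 𝓧) (κY : Kernel 𝓩 𝓨) (lam : Measure 𝓩) {M : ℕ} (B : Fin M → Set 𝓩)

/-- The law of `(X, Y, m)`, with `m` the label of the bin of `Z`, when `Z` has the law `lam`
and `(X, Y)` has the law `κX z ⊗ κY z` given `Z = z`. -/
noncomputable def binnedLaw : Measure (𝓧 × 𝓨 × Fin M) :=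
  ∑ m, ((κX ×ₖ κY) ∘ₘ lam.restrict (B m)).map (attachLabel m)

/-- The law with the same distributions of `(X, m)` and of `(Y, m)` as `binnedLaw`, under which `X`
and `Y` are conditionally independent given the label `m`. The inverse of `lam (B m)` is infinite
for a null bin; there it multiplies the zero measure. -/
noncomputable def decoupledLaw : Measure (𝓧 × 𝓨 × Fin M) :=
  ∑ m, ((κX ∘ₘ lam.restrict (B m)).prod
    ((lam (B m))⁻¹ • (κY ∘ₘ lam.restrict (B m)))).map (attachLabel m)

variable {B}

lemma IsBinning.sum_measure (hB : IsBinning B) : ∑ m, lam (B m) = lam Set.univ := by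
  rw [← hB.iUnion_eq, measure_iUnion hB.disjoint hB.measurableSet, tsum_fintype]

/-- The label of the bin of `z`. -/
noncomputable def IsBinning.label (hB : IsBinning B) (z : 𝓩) : Fin M :=
  Classical.choose (Set.mem_iUnion.1 (hB.iUnion_eq.symm ▸ Set.mem_univ z))

lemma IsBinning.mem_iff_label_eq (hB : IsBinning B) (z : 𝓩) (m : Fin M) :
    z ∈ B m ↔ hB.label z = m := by
  have hz : z ∈ B (hB.label z) :=
    Classical.choose_spec (Set.mem_iUnion.1 (hB.iUnion_eq.symm ▸ Set.mem_univ z))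
  constructor
  · intro h
    by_contra hne
    exact Set.disjoint_left.1 (hB.disjoint hne) hz h
  · rintro rfl
    exact hz

@[fun_prop]
lemma IsBinning.measurable_label (hB : IsBinning B) : Measurable hB.label := by
  refine measurable_to_countable' fun m => ?_
  convert hB.measurableSet m using 1
  ext z
  exact (hB.mem_iff_label_eq z m).symm

/-- Replace the `Z`-value of an observation by the label of its bin. -/
noncomputable def IsBinning.relabel (hB : IsBinning B) (w : 𝓧 × 𝓨 × 𝓩) : 𝓧 × 𝓨 × Fin M :=
  (w.1, w.2.1, hB.label w.2.2)

@[fun_prop]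
lemma IsBinning.measurable_relabel (hB : IsBinning B) :
    Measurable (hB.relabel : 𝓧 × 𝓨 × 𝓩 → 𝓧 × 𝓨 × Fin M) := by
  unfold IsBinning.relabel; fun_prop

lemma map_relabel_eq_binnedLaw (hB : IsBinning B) (P : Measure (𝓧 × 𝓨 × 𝓩))
    [IsProbabilityMeasure P] (h : IsCondIndepWith P κX κY) :
    P.map hB.relabel = binnedLaw κX κY (P.map fun w => w.2.2) B := by
  have hlaw := h.condIndep.map_eq
  set lam := P.map fun w : 𝓧 × 𝓨 × 𝓩 => w.2.2 with hlam
  have : IsProbabilityMeasure lam := Measure.isProbabilityMeasure_map (by fun_prop)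
  have hg : Measurable fun w : 𝓩 × 𝓧 × 𝓨 => (w.2.1, w.2.2, hB.label w.1) := by fun_prop
  have hmap : P.map hB.relabel = (lam ⊗ₘ (κX ×ₖ κY)).map
      fun w : 𝓩 × 𝓧 × 𝓨 => (w.2.1, w.2.2, hB.label w.1) := by
    rw [← hlaw, Measure.map_map hg (by fun_prop)]
    rfl
  ext s hs
  rw [hmap, Measure.map_apply hg hs, Measure.compProd_apply (hg hs), binnedLaw,
    Measure.finsetSum_apply, ← setLIntegral_univ, ← hB.iUnion_eq,
    lintegral_iUnion hB.measurableSet hB.disjoint, tsum_fintype]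
  refine Finset.sum_congr rfl fun m _ => ?_
  rw [Measure.map_apply (by fun_prop) hs, Measure.bind_apply (measurable_attachLabel m hs)
    (Kernel.aemeasurable _)]
  refine setLIntegral_congr_fun (hB.measurableSet m) fun z hz => ?_
  have := (hB.mem_iff_label_eq z m).1 hz
  congr 1
  ext w
  simp [attachLabel, this]

variable [IsMarkovKernel κX] [IsMarkovKernel κY] [IsProbabilityMeasure lam]

instance isFiniteMeasure_inv_smul (b : Set 𝓩) :
    IsFiniteMeasure ((lam b)⁻¹ • (κY ∘ₘ lam.restrict b)) := by
  refine ⟨?_⟩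
  rw [Measure.smul_apply, Measure.comp_apply_univ, Measure.restrict_apply_univ, smul_eq_mul]
  rcases eq_or_ne (lam b) 0 with h | h
  · simp [h]
  · rw [ENNReal.inv_mul_cancel h (measure_ne_top _ _)]
    exact ENNReal.one_lt_top

lemma isProbabilityMeasure_binnedLaw (hB : IsBinning B) :
    IsProbabilityMeasure (binnedLaw κX κY lam B) := by
  refine ⟨?_⟩
  rw [binnedLaw, Measure.finsetSum_apply, ← measure_univ (μ := lam), ← hB.sum_measure lam]
  refine Finset.sum_congr rfl fun m _ => ?_
  rw [Measure.map_apply (by fun_prop) .univ, Set.preimage_univ, Measure.comp_apply_univ,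
    Measure.restrict_apply_univ]

lemma isProbabilityMeasure_decoupledLaw (hB : IsBinning B) :
    IsProbabilityMeasure (decoupledLaw κX κY lam B) := by
  refine ⟨?_⟩
  rw [decoupledLaw, Measure.finsetSum_apply, ← measure_univ (μ := lam), ← hB.sum_measure lam]
  refine Finset.sum_congr rfl fun m _ => ?_
  rw [Measure.map_apply (by fun_prop) .univ, Set.preimage_univ, ← Set.univ_prod_univ,
    Measure.prod_prod, Measure.smul_apply, Measure.comp_apply_univ, Measure.comp_apply_univ,
    Measure.restrict_apply_univ, smul_eq_mul]
  rcases eq_or_ne (lam (B m)) 0 with h | h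
  · simp [h]
  · rw [ENNReal.inv_mul_cancel h (measure_ne_top _ _), mul_one]

/-- If all conditional distributions within a bin are at squared Hellinger distance at most `e`,
then `binnedLaw` and `decoupledLaw` are at squared Hellinger distance at most `2 e ^ 2`. -/
lemma hellSq_binnedLaw_decoupledLaw_le (hB : IsBinning B) {e : ℝ≥0∞}
    (hX : ∀ m, ∀ z ∈ B m, ∀ z' ∈ B m, hellSq (κX z) (κX z') ≤ e)
    (hY : ∀ m, ∀ z ∈ B m, ∀ z' ∈ B m, hellSq (κY z) (κY z') ≤ e) :
    hellSq (binnedLaw κX κY lam B) (decoupledLaw κX κY lam B) ≤ 2 * e ^ 2 := by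
  have := isProbabilityMeasure_binnedLaw κX κY lam hB
  have := isProbabilityMeasure_decoupledLaw κX κY lam hB
  refine hellSq_le_of_forall_lintegral_le _ _ fun ρ hρ hρ0 => ?_
  have he : e ^ 2 = ∑ m, lam (B m) * e ^ 2 := by
    rw [← Finset.sum_mul, hB.sum_measure lam, measure_univ, one_mul]
  rw [he, binnedLaw, decoupledLaw]
  simp only [lintegral_finsetSum_measure]
  rw [← Finset.sum_add_distrib]
  simp only [Finset.mul_sum]
  rw [← Finset.sum_add_distrib, ← Finset.sum_add_distrib]
  refine Finset.sum_le_sum fun m _ => ?_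
  rw [lintegral_map (by fun_prop) (by fun_prop), lintegral_map (by fun_prop) (by fun_prop),
    lintegral_map (by fun_prop) (by fun_prop), lintegral_map (by fun_prop) (by fun_prop)]
  have hmain := lintegral_mixture_le κX κY (lam.restrict (B m)) (b := B m)
    (ae_restrict_mem (hB.measurableSet m)) (hX m) (hY m) (ρ := fun w => ρ (attachLabel m w))
    (by fun_prop) (fun w => hρ0 _)
  rw [Measure.restrict_apply_univ] at hmain
  rw [Measure.prod_smul_right, lintegral_smul_measure, lintegral_smul_measure, smul_eq_mul,
    smul_eq_mul]
  generalize ∫⁻ w, ENNReal.ofReal ((2 * ρ (attachLabel m w) - 1) ^ 2)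
    ∂((κX ∘ₘ lam.restrict (B m)).prod (κY ∘ₘ lam.restrict (B m))) = t₂ at *
  generalize ∫⁻ w, ENNReal.ofReal (ρ (attachLabel m w))
    ∂((κX ∘ₘ lam.restrict (B m)).prod (κY ∘ₘ lam.restrict (B m))) = t₁ at *
  rcases eq_or_ne (lam (B m)) 0 with h | h
  · simp [Measure.restrict_eq_zero.2 h]
  · have hi := ENNReal.inv_mul_cancel h (measure_ne_top lam (B m))
    generalize ∫⁻ w, ENNReal.ofReal ((2 * ρ (attachLabel m w) - 1) ^ 2)
      ∂((κX ×ₖ κY) ∘ₘ lam.restrict (B m)) = j₂ at *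
    generalize ∫⁻ w, ENNReal.ofReal (ρ (attachLabel m w))
      ∂((κX ×ₖ κY) ∘ₘ lam.restrict (B m)) = j₁ at *
    generalize lam (B m) = v at *
    calc 8 * j₁ = (v⁻¹ * v) * (8 * j₁) := by rw [hi, one_mul]
      _ = v⁻¹ * (8 * (v * j₁)) := by ring
      _ ≤ v⁻¹ * (4 * (v ^ 2 * e ^ 2) + 2 * (v * j₂ + t₂) + 8 * t₁) := by gcongr
      _ = (v⁻¹ * v) * (4 * (v * e ^ 2)) + (2 * ((v⁻¹ * v) * j₂ + v⁻¹ * t₂))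
          + 8 * (v⁻¹ * t₁) := by ring
      _ = _ := by rw [hi, one_mul, one_mul]

end Binned

/-! ### Validity of permutation p-values for given bin sizes -/

section FixedSizes

variable {𝓧 𝓨 : Type*} {M : ℕ} {k : Fin M → ℕ}

/-- Binned data with given bin sizes `k`. -/
def pack (U : ∀ m, Fin (k m) → 𝓧 × 𝓨) : Fin M → BinSample 𝓧 𝓨 := fun m => ⟨k m, U m⟩

/-- The action of local permutations on binned data with given bin sizes. -/
def permuteBins (π : ∀ m, Equiv.Perm (Fin (k m))) (U : ∀ m, Fin (k m) → 𝓧 × 𝓨) :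
    ∀ m, Fin (k m) → 𝓧 × 𝓨 := fun m j => ((U m j).1, (U m (π m j)).2)

lemma permuteBins_permuteBins (π π' : ∀ m, Equiv.Perm (Fin (k m)))
    (U : ∀ m, Fin (k m) → 𝓧 × 𝓨) :
    permuteBins π' (permuteBins π U) = permuteBins (π * π') U := rfl

open Classical in
lemma permPValue_pack (f : (Fin M → BinSample 𝓧 𝓨) → ℝ) (U : ∀ m, Fin (k m) → 𝓧 × 𝓨) :
    permPValue f (pack U) = (1 / (∏ m, ((k m)! : ℝ))) *
      ∑ π : ∀ m, Equiv.Perm (Fin (k m)),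
        if f (pack U) ≤ f (pack (permuteBins π U)) then 1 else 0 := rfl

open Classical in
/-- Among the values `T g`, `g` in a finite type `G`, at most a proportion `α` have an upper rank at
most `α * card G`. -/
lemma card_filter_rank_le {G : Type*} [Fintype G] (T : G → ℝ) {α : ℝ} (hα : 0 ≤ α) :
    ((Finset.univ.filter fun g => ((Finset.univ.filter fun g' => T g ≤ T g').card : ℝ)
      ≤ α * Fintype.card G).card : ℝ) ≤ α * Fintype.card G := by
  set A := Finset.univ.filter fun g => ((Finset.univ.filter fun g' => T g ≤ T g').card : ℝ)
      ≤ α * Fintype.card G with hA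
  rcases A.eq_empty_or_nonempty with h | h
  · rw [h, Finset.card_empty, Nat.cast_zero]
    positivity
  -- every element of `A` is counted in the rank of an element of `A` with the smallest value
  · obtain ⟨g, hg, hmin⟩ := A.exists_min_image T h
    have hsub : A ⊆ Finset.univ.filter fun g' => T g ≤ T g' := fun g' hg' => by
      simpa using hmin g' hg'
    exact (Nat.cast_le.2 (Finset.card_le_card hsub)).trans (Finset.mem_filter.1 hg).2

open Classical in
/-- On every orbit of the local permutations, the test rejects for a proportion at most `α`. -/
lemma sum_permuteBins_le (f : (Fin M → BinSample 𝓧 𝓨) → ℝ) {α : ℝ} (hα : 0 ≤ α)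
    (U : ∀ m, Fin (k m) → 𝓧 × 𝓨) :
    ∑ π : ∀ m, Equiv.Perm (Fin (k m)),
      (if permPValue f (pack (permuteBins π U)) ≤ α then (1 : ℝ≥0∞) else 0)
      ≤ ENNReal.ofReal α * Fintype.card (∀ m, Equiv.Perm (Fin (k m))) := by
  set G := ∀ m, Equiv.Perm (Fin (k m)) with hG
  have hcard : (∏ m, ((k m)! : ℝ)) = Fintype.card G := by
    rw [Fintype.card_pi, Nat.cast_prod]
    exact Finset.prod_congr rfl fun m _ => by rw [Fintype.card_perm, Fintype.card_fin]
  have hpos : (0 : ℝ) < Fintype.card G := by exact_mod_cast Fintype.card_pos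
  have hiff : ∀ π : G, permPValue f (pack (permuteBins π U)) ≤ α ↔
      ((Finset.univ.filter fun π' : G =>
        f (pack (permuteBins π U)) ≤ f (pack (permuteBins π' U))).card : ℝ)
        ≤ α * Fintype.card G := by
    intro π
    rw [permPValue_pack, hcard, one_div, inv_mul_le_iff₀ hpos, mul_comm (Fintype.card G : ℝ) α]
    simp only [permuteBins_permuteBins]
    rw [← Finset.sum_boole, ← Equiv.sum_comp (Equiv.mulLeft π)
      fun π' : G => if f (pack (permuteBins π U)) ≤ f (pack (permuteBins π' U)) then (1 : ℝ) else 0]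
    rfl
  simp only [hiff]
  rw [Finset.sum_boole, ← ENNReal.ofReal_natCast, ← ENNReal.ofReal_natCast,
    ← ENNReal.ofReal_mul hα]
  exact ENNReal.ofReal_le_ofReal (card_filter_rank_le _ hα)

variable [MeasurableSpace 𝓧] [MeasurableSpace 𝓨]

lemma measurable_pack :
    Measurable (pack : (∀ m, Fin (k m) → 𝓧 × 𝓨) → Fin M → BinSample 𝓧 𝓨) := by
  refine measurable_pi_lambda _ fun m => ?_
  have hmk : Measurable (Sigma.mk (β := fun j : ℕ => Fin j → 𝓧 × 𝓨) (k m)) :=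
    fun s hs => MeasurableSpace.measurableSet_iInf.1 hs (k m)
  exact hmk.comp (measurable_pi_apply m)

lemma measurable_permuteBins (π : ∀ m, Equiv.Perm (Fin (k m))) :
    Measurable (permuteBins π : (∀ m, Fin (k m) → 𝓧 × 𝓨) → ∀ m, Fin (k m) → 𝓧 × 𝓨) := by
  unfold permuteBins; fun_prop

lemma measurable_permPValue_pack {f : (Fin M → BinSample 𝓧 𝓨) → ℝ} (hf : Measurable f) :
    Measurable fun U : ∀ m, Fin (k m) → 𝓧 × 𝓨 => permPValue f (pack U) := by
  simp only [permPValue_pack]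
  refine measurable_const.mul (Finset.univ.measurable_fun_sum fun π _ => ?_)
  exact Measurable.ite (measurableSet_le (hf.comp measurable_pack)
    (hf.comp (measurable_pack.comp (measurable_permuteBins π)))) measurable_const measurable_const

end FixedSizes

/-! ### Exact validity under conditional independence within bins -/

section Validity

variable {𝓧 𝓨 : Type*} {n M : ℕ}

/-- The bins of labelled data: one for each label. -/
def labelBins (M : ℕ) : Fin M → Set (Fin M) := fun m => {m}

open Classical in
/-- The indices of the observations with label `m`, when the labels are `b`. -/
noncomputable def fiberIndices (b : Fin n → Fin M) (m : Fin M) : Finset (Fin n) :=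
  Finset.univ.filter fun i => b i ∈ labelBins M m

lemma mem_fiberIndices {b : Fin n → Fin M} {m : Fin M} {i : Fin n} :
    i ∈ fiberIndices b m ↔ b i = m := by
  simp [fiberIndices, labelBins]

/-- The `j`-th observation with label `m`. -/
noncomputable def fiberIndex (b : Fin n → Fin M) (m : Fin M) (j : Fin (fiberIndices b m).card) :
    Fin n := (fiberIndices b m).orderEmbOfFin rfl j

/-- The pairs in `v`, sorted into bins according to the labels `b`. -/
noncomputable def sortPairs (b : Fin n → Fin M) (v : Fin n → 𝓧 × 𝓨) :
    ∀ m, Fin (fiberIndices b m).card → 𝓧 × 𝓨 := fun m j => v (fiberIndex b m j)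

/-- Attach the labels `b` to the pairs `v`. -/
def attachLabels (b : Fin n → Fin M) (v : Fin n → 𝓧 × 𝓨) : Fin n → 𝓧 × 𝓨 × Fin M :=
  fun i => attachLabel (b i) (v i)

lemma binnedData_attachLabels (b : Fin n → Fin M) (v : Fin n → 𝓧 × 𝓨) :
    binnedData (labelBins M) (attachLabels b v) = pack (sortPairs b v) := rfl

/-- The action of a permutation of the second coordinates. -/
def swapSnd (τ : Equiv.Perm (Fin n)) (v : Fin n → 𝓧 × 𝓨) : Fin n → 𝓧 × 𝓨 :=
  fun i => ((v i).1, (v (τ i)).2)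

lemma fiberIndex_bijective (b : Fin n → Fin M) :
    Function.Bijective fun s : Σ m, Fin (fiberIndices b m).card => fiberIndex b s.1 s.2 := by
  constructor
  · rintro ⟨m, j⟩ ⟨m', j'⟩ h
    have h1 : b (fiberIndex b m j) = m :=
      mem_fiberIndices.1 (Finset.orderEmbOfFin_mem _ rfl j)
    have h2 : b (fiberIndex b m' j') = m' :=
      mem_fiberIndices.1 (Finset.orderEmbOfFin_mem _ rfl j')
    obtain rfl : m = m' := by
      rw [← h1, ← h2]; exact congrArg b h
    obtain rfl : j = j' := ((fiberIndices b m).orderEmbOfFin rfl).injective h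
    rfl
  · intro i
    have : i ∈ Set.range ((fiberIndices b (b i)).orderEmbOfFin rfl) := by
      rw [Finset.range_orderEmbOfFin]
      exact mem_fiberIndices.2 rfl
    obtain ⟨j, hj⟩ := this
    exact ⟨⟨b i, j⟩, hj⟩

/-- A local permutation acts as a permutation of all the observations that preserves the labels. -/
lemma exists_perm_sortPairs_swapSnd (b : Fin n → Fin M)
    (π : ∀ m, Equiv.Perm (Fin (fiberIndices b m).card)) :
    ∃ τ : Equiv.Perm (Fin n), (∀ i, b (τ i) = b i) ∧ ∀ v : Fin n → 𝓧 × 𝓨,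
      sortPairs b (swapSnd τ v) = permuteBins π (sortPairs b v) := by
  set e := Equiv.ofBijective _ (fiberIndex_bijective b) with he
  have hb : ∀ s, b (e s) = s.1 := fun s => mem_fiberIndices.1 (Finset.orderEmbOfFin_mem _ rfl s.2)
  refine ⟨(e.symm.trans (Equiv.sigmaCongrRight π)).trans e, fun i => ?_, fun v => ?_⟩
  · rw [Equiv.trans_apply, Equiv.trans_apply, hb, ← e.apply_symm_apply i, hb,
      Equiv.symm_apply_apply]
    rfl
  · funext m j
    have h : e.symm (fiberIndex b m j) = ⟨m, j⟩ := e.symm_apply_apply ⟨m, j⟩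
    simp only [sortPairs, swapSnd, permuteBins, Equiv.trans_apply, h]
    rfl

/-- The event that the labels are `b`. -/
def labelEvent (𝓧 𝓨 : Type*) (b : Fin n → Fin M) : Set (Fin n → 𝓧 × 𝓨 × Fin M) :=
  Set.univ.pi fun i => {w | w.2.2 = b i}

lemma iUnion_labelEvent : ⋃ b : Fin n → Fin M, labelEvent 𝓧 𝓨 b = Set.univ :=
  Set.eq_univ_of_forall fun w => Set.mem_iUnion.2 ⟨fun i => (w i).2.2, fun _ _ => rfl⟩

lemma pairwise_disjoint_labelEvent :
    Pairwise fun b b' : Fin n → Fin M => Disjoint (labelEvent 𝓧 𝓨 b) (labelEvent 𝓧 𝓨 b') :=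
  fun _ _ hne => Set.disjoint_left.2 fun _ hw hw' =>
    hne (funext fun i => (hw i trivial).symm.trans (hw' i trivial))

lemma attachLabels_of_mem_labelEvent {b : Fin n → Fin M} {w : Fin n → 𝓧 × 𝓨 × Fin M}
    (hw : w ∈ labelEvent 𝓧 𝓨 b) : attachLabels b (fun i => ((w i).1, (w i).2.1)) = w := by
  funext i
  rw [attachLabels, attachLabel, ← hw i trivial]

variable [MeasurableSpace 𝓧] [MeasurableSpace 𝓨]

/-- A permutation that preserves the labels, applied to the second coordinates, preserves a product
of product measures that depend on the labels. -/
lemma measurePreserving_swapSnd (A : Fin M → Measure 𝓧) (C : Fin M → Measure 𝓨)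
    [∀ m, IsFiniteMeasure (A m)] [∀ m, IsFiniteMeasure (C m)] (b : Fin n → Fin M)
    {τ : Equiv.Perm (Fin n)} (hτ : ∀ i, b (τ i) = b i) :
    MeasurePreserving (swapSnd τ) (Measure.pi fun i => (A (b i)).prod (C (b i)))
      (Measure.pi fun i => (A (b i)).prod (C (b i))) := by
  have h1 := measurePreserving_arrowProdEquivProdArrow 𝓧 𝓨 (Fin n) (fun i => A (b i))
    (fun i => C (b i))
  have h2 : MeasurePreserving (fun (y : Fin n → 𝓨) i => y (τ i))
      (Measure.pi fun i => C (b i)) (Measure.pi fun i => C (b i)) := by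
    refine ⟨by fun_prop, (Measure.pi_eq fun t ht => ?_).symm⟩
    rw [Measure.map_apply (by fun_prop) (.univ_pi ht)]
    have e : (fun (y : Fin n → 𝓨) i => y (τ i)) ⁻¹' Set.univ.pi t
        = Set.univ.pi fun i => t (τ.symm i) := by
      ext y
      simp only [Set.mem_preimage, Set.mem_pi, Set.mem_univ, true_imp_iff]
      exact ⟨fun h i => by simpa using h (τ.symm i), fun h i => by simpa using h (τ i)⟩
    rw [e, Measure.pi_pi, ← Equiv.prod_comp τ]
    exact Finset.prod_congr rfl fun i _ => by rw [hτ, Equiv.symm_apply_apply]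
  exact (h1.symm.comp ((MeasurePreserving.id _).prod h2)).comp h1

lemma measurableSet_label_eq (m : Fin M) : MeasurableSet {w : 𝓧 × 𝓨 × Fin M | w.2.2 = m} :=
  (measurableSet_singleton m).preimage (by fun_prop : Measurable fun w : 𝓧 × 𝓨 × Fin M => w.2.2)

lemma measurableSet_labelEvent (b : Fin n → Fin M) : MeasurableSet (labelEvent 𝓧 𝓨 b) :=
  .univ_pi fun i => measurableSet_label_eq (b i)

lemma measurable_attachLabels (b : Fin n → Fin M) :
    Measurable (attachLabels b : (Fin n → 𝓧 × 𝓨) → _) := by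
  unfold attachLabels; fun_prop

lemma measurable_sortPairs (b : Fin n → Fin M) :
    Measurable (sortPairs b : (Fin n → 𝓧 × 𝓨) → _) := by
  unfold sortPairs; fun_prop

lemma measurable_permTest_labelBins {f : (Fin M → BinSample 𝓧 𝓨) → ℝ} (hf : Measurable f)
    (α : ℝ) : Measurable (permTest (n := n) (labelBins M) f α) := by
  classical
  have hset : MeasurableSet {w : Fin n → 𝓧 × 𝓨 × Fin M |
      permPValue f (binnedData (labelBins M) w) ≤ α} := by
    have e : {w : Fin n → 𝓧 × 𝓨 × Fin M | permPValue f (binnedData (labelBins M) w) ≤ α}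
        = ⋃ b : Fin n → Fin M, labelEvent 𝓧 𝓨 b ∩
          (fun w i => ((w i).1, (w i).2.1)) ⁻¹'
            {v | permPValue f (pack (sortPairs b v)) ≤ α} := by
      ext w
      simp only [Set.mem_ofPred_eq, Set.mem_iUnion, Set.mem_inter_iff, Set.mem_preimage,
        ← binnedData_attachLabels]
      constructor
      · intro h
        have hw : w ∈ labelEvent 𝓧 𝓨 fun i => (w i).2.2 := fun _ _ => rfl
        exact ⟨_, hw, by rwa [attachLabels_of_mem_labelEvent hw]⟩
      · rintro ⟨b, hw, h⟩
        rwa [attachLabels_of_mem_labelEvent hw] at h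
    rw [e]
    refine .iUnion fun b => (measurableSet_labelEvent b).inter (MeasurableSet.preimage ?_
      (by fun_prop))
    exact measurableSet_le ((measurable_permPValue_pack hf).comp (measurable_sortPairs b))
      measurable_const
  exact Measurable.ite hset measurable_const measurable_const

variable (A : Fin M → Measure 𝓧) (C : Fin M → Measure 𝓨)

lemma restrict_label_eq (m : Fin M) :
    (∑ m', ((A m').prod (C m')).map (attachLabel m')).restrict
      {w : 𝓧 × 𝓨 × Fin M | w.2.2 = m} = ((A m).prod (C m)).map (attachLabel m) := by
  ext s hs
  rw [Measure.restrict_apply hs, Measure.finsetSum_apply, Finset.sum_eq_single m]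
  · rw [Measure.map_apply (by fun_prop) (hs.inter (measurableSet_label_eq m)),
      Measure.map_apply (by fun_prop) hs]
    congr 1
    ext w
    simp [attachLabel]
  · intro m' _ hne
    rw [Measure.map_apply (by fun_prop) (hs.inter (measurableSet_label_eq m))]
    convert measure_empty (μ := (A m').prod (C m'))
    ext w
    simp [attachLabel, hne]
  · simp

open Classical in
/-- Under a law of labelled pairs for which the coordinates are independent given the label, the
permutation test has level `α`. -/
lemma lintegral_permTest_labelBins_le [∀ m, IsFiniteMeasure (A m)] [∀ m, IsFiniteMeasure (C m)]
    [IsProbabilityMeasure (∑ m, ((A m).prod (C m)).map (attachLabel m))]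
    {f : (Fin M → BinSample 𝓧 𝓨) → ℝ} (hf : Measurable f) {α : ℝ} (hα : 0 ≤ α) :
    ∫⁻ w, permTest (labelBins M) f α w
        ∂(Measure.pi fun _ : Fin n => ∑ m, ((A m).prod (C m)).map (attachLabel m))
      ≤ ENNReal.ofReal α := by
  set S := ∑ m, ((A m).prod (C m)).map (attachLabel m) with hS
  have hT := measurable_permTest_labelBins (n := n) hf α
  have split : ∀ F : (Fin n → 𝓧 × 𝓨 × Fin M) → ℝ≥0∞,
      ∫⁻ w, F w ∂(Measure.pi fun _ : Fin n => S)
        = ∑ b, ∫⁻ w in labelEvent 𝓧 𝓨 b, F w ∂(Measure.pi fun _ : Fin n => S) := by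
    intro F
    rw [← setLIntegral_univ, ← iUnion_labelEvent,
      lintegral_iUnion measurableSet_labelEvent pairwise_disjoint_labelEvent, tsum_fintype]
  have hrestrict : ∀ b : Fin n → Fin M,
      (Measure.pi fun _ : Fin n => S).restrict (labelEvent 𝓧 𝓨 b)
        = (Measure.pi fun i => (A (b i)).prod (C (b i))).map (attachLabels b) := by
    intro b
    rw [labelEvent, Measure.restrict_pi_pi]
    simp only [hS, restrict_label_eq]
    exact (Measure.pi_map_pi fun i => (measurable_attachLabel (b i)).aemeasurable).symm
  have hone : ENNReal.ofReal α = ∑ b : Fin n → Fin M,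
      ENNReal.ofReal α * (Measure.pi fun i => (A (b i)).prod (C (b i))) Set.univ := by
    rw [← Finset.mul_sum]
    have h1 := split fun _ => 1
    simp only [hrestrict, lintegral_one, measure_univ] at h1
    rw [Finset.sum_congr rfl fun b _ =>
      Measure.map_apply (measurable_attachLabels b) MeasurableSet.univ] at h1
    simp only [Set.preimage_univ] at h1
    rw [← h1, mul_one]
  rw [split, hone]
  refine Finset.sum_le_sum fun b _ => ?_
  rw [hrestrict, lintegral_map hT (measurable_attachLabels b)]
  set Q := Measure.pi fun i => (A (b i)).prod (C (b i)) with hQ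
  set G := ∀ m, Equiv.Perm (Fin (fiberIndices b m).card) with hG
  let ψ : (∀ m, Fin (fiberIndices b m).card → 𝓧 × 𝓨) → ℝ≥0∞ := fun U =>
    if permPValue f (pack U) ≤ α then 1 else 0
  have hψ : Measurable ψ := Measurable.ite
    (measurableSet_le (measurable_permPValue_pack hf) measurable_const) measurable_const
    measurable_const
  change ∫⁻ v, ψ (sortPairs b v) ∂Q ≤ _
  -- the rejection probability is the same for all local permutations of the data
  have hinv : ∀ π : G, ∫⁻ v, ψ (permuteBins π (sortPairs b v)) ∂Q
      = ∫⁻ v, ψ (sortPairs b v) ∂Q := by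
    intro π
    obtain ⟨τ, hτ, h⟩ := exists_perm_sortPairs_swapSnd (𝓧 := 𝓧) (𝓨 := 𝓨) b π
    simp only [← h]
    exact (measurePreserving_swapSnd A C b hτ).lintegral_comp (hψ.comp (measurable_sortPairs b))
  have hc0 : (Fintype.card G : ℝ≥0∞) ≠ 0 := by
    exact_mod_cast Fintype.card_ne_zero
  refine (ENNReal.mul_le_mul_iff_right hc0 (ENNReal.natCast_ne_top _)).1 ?_
  calc (Fintype.card G : ℝ≥0∞) * ∫⁻ v, ψ (sortPairs b v) ∂Q
      = ∑ π : G, ∫⁻ v, ψ (permuteBins π (sortPairs b v)) ∂Q := by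
        simp only [hinv, Finset.sum_const, Finset.card_univ, nsmul_eq_mul]
    _ = ∫⁻ v, ∑ π : G, ψ (permuteBins π (sortPairs b v)) ∂Q :=
        (lintegral_finsetSum _ fun π _ =>
          hψ.comp ((measurable_permuteBins π).comp (measurable_sortPairs b))).symm
    _ ≤ ∫⁻ _, ENNReal.ofReal α * Fintype.card G ∂Q :=
        lintegral_mono fun v => sum_permuteBins_le f hα _
    _ = Fintype.card G * (ENNReal.ofReal α * Q Set.univ) := by
        rw [lintegral_const]; ring

end Validity

/-! ### Type I error on the null class -/

section TypeOne

variable {𝓧 𝓨 𝓩 : Type*} {n M : ℕ}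

/-- The content of a bin depends on the bin and on the `Z`-values only through the set of indices
of the observations in the bin. -/
lemma binSample_congr {𝓩' : Type*} {b : Set 𝓩} {b' : Set 𝓩'} {w : Fin n → 𝓧 × 𝓨 × 𝓩}
    {w' : Fin n → 𝓧 × 𝓨 × 𝓩'} (h : binIndices b w = binIndices b' w')
    (h1 : ∀ i, (w i).1 = (w' i).1) (h2 : ∀ i, (w i).2.1 = (w' i).2.1) :
    binSample b w = binSample b' w' := by
  have key : ∀ s t : Finset (Fin n), s = t →
      (⟨s.card, fun j => ((w' (s.orderEmbOfFin rfl j)).1, (w' (s.orderEmbOfFin rfl j)).2.1)⟩ :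
        BinSample 𝓧 𝓨)
      = ⟨t.card, fun j => ((w' (t.orderEmbOfFin rfl j)).1, (w' (t.orderEmbOfFin rfl j)).2.1)⟩ := by
    rintro s _ rfl
    rfl
  unfold binSample
  simp only [h1, h2]
  exact key _ _ h

variable [MeasurableSpace 𝓩] {B : Fin M → Set 𝓩}

lemma binnedData_eq_relabel (hB : IsBinning B) (w : Fin n → 𝓧 × 𝓨 × 𝓩) :
    binnedData B w = binnedData (labelBins M) fun i => hB.relabel (w i) := by
  funext m
  refine binSample_congr ?_ (fun _ => rfl) (fun _ => rfl)
  ext i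
  simp only [binIndices, Finset.mem_filter, Finset.mem_univ, true_and, hB.mem_iff_label_eq]
  rfl

lemma permTest_eq_relabel (hB : IsBinning B) (f : (Fin M → BinSample 𝓧 𝓨) → ℝ) (α : ℝ)
    (w : Fin n → 𝓧 × 𝓨 × 𝓩) :
    permTest B f α w = permTest (labelBins M) f α fun i => hB.relabel (w i) := by
  unfold permTest
  rw [binnedData_eq_relabel hB]

/-- Within a bin, the conditional distributions are close in Hellinger distance. -/
lemma RenyiLipschitz.hellSq_le {Ω : Type*} [MeasurableSpace Ω] [PseudoMetricSpace 𝓩]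
    {γ : ℝ} (hγ : 0 < γ) {L : ℝ≥0} {κ : Kernel 𝓩 Ω}
    [IsMarkovKernel κ] (h : RenyiLipschitz γ L κ) (m : Fin M) {z z' : 𝓩} (hz : z ∈ B m)
    (hz' : z' ∈ B m) : hellSq (κ z) (κ z') ≤ hellConst γ * (L * maxDiam B) ^ 2 := by
  have hd : edist z z' ≤ maxDiam B :=
    le_iSup_of_le m (le_iSup₂_of_le z hz (le_iSup₂_of_le z' hz' le_rfl))
  refine (hellSq_le_renyiDiv (κ z) (κ z') hγ).trans ?_
  gcongr
  have h1 := (h z z').trans (mul_le_mul_right hd _)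
  calc renyiDiv γ (κ z) (κ z') = (renyiDiv γ (κ z) (κ z') ^ (1 / 2 : ℝ)) ^ 2 := by
        rw [← ENNReal.rpow_natCast, ← ENNReal.rpow_mul]; norm_num
    _ ≤ _ := by gcongr

lemma lintegral_permTest_le [MeasurableSpace 𝓧] [MeasurableSpace 𝓨] [PseudoMetricSpace 𝓩]
    (hB : IsBinning B) {f : (Fin M → BinSample 𝓧 𝓨) → ℝ} (hf : Measurable f)
    {γ : ℝ} (hγ : 0 < γ) {L : ℝ≥0} {α : ℝ} (hα : 0 ≤ α) {P : Measure (𝓧 × 𝓨 × 𝓩)}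
    (hP : P ∈ renyiNull 𝓧 𝓨 𝓩 γ L) :
    ∫⁻ w, permTest B f α w ∂(Measure.pi fun _ : Fin n => P)
      ≤ ENNReal.ofReal α + (4 * hellConst γ : ℝ≥0) * (n : ℝ≥0∞) ^ (1 / 2 : ℝ) * (L : ℝ≥0∞) ^ 2
        * maxDiam B ^ 2 := by
  obtain ⟨hprob, κX, κY, hκX, hκY, hcond, hX, hY⟩ := hP
  set lam := P.map fun w => w.2.2 with hlam
  have : IsProbabilityMeasure lam := Measure.isProbabilityMeasure_map (by fun_prop)
  set R := binnedLaw κX κY lam B with hR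
  set S := decoupledLaw κX κY lam B with hS
  have hRprob : IsProbabilityMeasure R := isProbabilityMeasure_binnedLaw κX κY lam hB
  have hSprob : IsProbabilityMeasure S := isProbabilityMeasure_decoupledLaw κX κY lam hB
  have hT := measurable_permTest_labelBins (n := n) hf α
  set e : ℝ≥0∞ := hellConst γ * (L * maxDiam B) ^ 2 with he
  have hhell : hellSq R S ≤ 2 * e ^ 2 := hellSq_binnedLaw_decoupledLaw_le κX κY lam hB
    (fun m _ hz _ hz' => hX.hellSq_le hγ m hz hz') (fun m _ hz _ hz' => hY.hellSq_le hγ m hz hz')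
  have hlevel : ∫⁻ w, permTest (labelBins M) f α w ∂(Measure.pi fun _ : Fin n => S)
      ≤ ENNReal.ofReal α := by
    have hSprob' := hSprob
    rw [hS, decoupledLaw] at hSprob' ⊢
    exact lintegral_permTest_labelBins_le _ _ hf hα
  have hpi : Measure.pi (fun _ : Fin n => R)
      = (Measure.pi fun _ : Fin n => P).map fun w i => hB.relabel (w i) := by
    rw [hR, ← map_relabel_eq_binnedLaw κX κY hB P hcond]
    have := fun _ : Fin n => Measure.isProbabilityMeasure_map (μ := P)
      hB.measurable_relabel.aemeasurable
    exact (Measure.pi_map_pi fun _ => hB.measurable_relabel.aemeasurable).symm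
  have hmove : ∫⁻ w, permTest B f α w ∂(Measure.pi fun _ : Fin n => P)
      = ∫⁻ w, permTest (labelBins M) f α w ∂(Measure.pi fun _ : Fin n => R) := by
    rw [hpi, lintegral_map hT (by fun_prop)]
    exact lintegral_congr fun w => permTest_eq_relabel hB f α w
  rw [hmove]
  refine (lintegral_pi_le_add_hellSq R S n hT fun w => ?_).trans (add_le_add hlevel ?_)
  · unfold permTest
    split_ifs <;> simp
  calc 2 * ((n : ℝ≥0∞) * hellSq R S) ^ (1 / 2 : ℝ)
      ≤ 2 * ((n : ℝ≥0∞) * (2 * e) ^ 2) ^ (1 / 2 : ℝ) := by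
        gcongr
        refine hhell.trans ?_
        rw [mul_pow 2 e]
        have h24 : (2 : ℝ≥0∞) ≤ 2 ^ 2 := by norm_num
        exact mul_le_mul' h24 le_rfl
    _ = 2 * ((n : ℝ≥0∞) ^ (1 / 2 : ℝ) * (2 * e)) := by
        rw [ENNReal.mul_rpow_of_nonneg _ _ (by norm_num), ← ENNReal.rpow_natCast,
          ← ENNReal.rpow_mul]
        norm_num
    _ = _ := by
        rw [he]
        push_cast
        ring

end TypeOne

end LocalPerm

theorem mainTheorem3 (γ : ℝ) (hγ : 0 < γ) :
    ∃ C : ℝ≥0, ∀ (𝓧 : Type*) (𝓨 : Type*) (𝓩 : Type*)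
      [MeasurableSpace 𝓧] [MeasurableSpace 𝓨] [MeasurableSpace 𝓩] [PseudoMetricSpace 𝓩]
      (n M : ℕ) (B : Fin M → Set 𝓩) (_ : LocalPerm.IsBinning B)
      (f : (Fin M → LocalPerm.BinSample 𝓧 𝓨) → ℝ) (_ : Measurable f)
      (L : ℝ≥0) (α : ℝ) (_ : 0 < α) (_ : α < 1),
      ⨆ P ∈ LocalPerm.renyiNull 𝓧 𝓨 𝓩 γ L,
          ∫⁻ w, LocalPerm.permTest B f α w ∂(Measure.pi fun _ : Fin n => P)
        ≤ ENNReal.ofReal α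
          + C * (n : ℝ≥0∞) ^ (1 / 2 : ℝ) * (L : ℝ≥0∞) ^ 2 * LocalPerm.maxDiam B ^ 2 :=
  ⟨4 * LocalPerm.hellConst γ, fun _ _ _ _ _ _ _ _ _ _ hB _ hf _ _ hα _ =>
    iSup₂_le fun _ hP => LocalPerm.lintegral_permTest_le hB hf hγ hα.le hP⟩
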